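/- **Setting.** A system has a finite set $\mathcal V$ of $n$ validators, of which at most $f$ are Byzantine (the others are honest), and $n \ge 3f+2p+1$. There are user actors $A$ and reactive actors $X$; every validator $V$ keeps an entity $V.A$ resp. $V.X$ for each of them. A user transaction has a sender (a user actor), a sequence number, consumed objects and a signature; it is a UA-RA transaction if it has a recipient (a reactive actor). An RA-RA transaction is issued by a reactive actor and has no sequence number. A block is a finite set of transactions. The network is partially synchronous: a message sent between honest validators at time $t$ is delivered by $\max(t+\Delta,\mathrm{GST}+\Delta)$, where $\Delta>0$; local steps and messages inside an honest validator take finite time. Signatures of honest validators cannot be forged. **POA for $X$.** Each $V.X$ has a pool of transactions. Once $V.X$ is initialized (which eventually happens at every honest $V$), it initiates instance $1$; when it decides a block $B$ in instance $k$, it removes $B$ from its pool and initiates instance $k+1$. It decides in instance $k$ only after initiating it and only once; messages for instance $k$ that arrive earlier are kept. In instance $k$ an honest $V.X$ acts as follows. 1. *Proposal.* If $V$ is the leader of instance $k$ (given by a common oracle), $V.X$ broadcasts its pool. A timer is started. 2. *Vote.* If, before the timer exceeds $3\Delta$, $V.X$ has received a block $B$ from the leader and all RA-RA transactions of $B$ are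 in its pool, it asks, for every UA-RA transaction $tx\in B$ with sender $A$, the entity $V.A$ to FP-lock $tx$. $V.A$ answers *fail* if the signature is wrong or another transaction with the same sequence number is FP-locked; otherwise it FP-locks $tx$ and answers *success* if the preceding sequence number is executed and $A$ owns the consumed objects within time $\Delta$, and *fail* after that. When all answers are there, $V.X$ broadcasts a ballot: a vote for $B$ if all answers were *success*, a negative vote otherwise, together with its current pool as fallback block. If the timer exceeds $3\Delta$ without FP-lock requests having been made, $V.X$ broadcasts a negative vote with its fallback block. 3. *Fast path.* If $V.X$ has votes for a block $B$ from at least $n-p$ validators, it broadcasts these votes as a proof and decides $B$. If it receives a valid proof for $B$, it rebroadcasts it and decides $B$. 4. *Slow path.* When the timer has exceeded $3\Delta$ and ballots from at least $n-f$ validators have arrived, then, if some block $B$ has at least $n-p-2f$ votes, $V.X$ picks such a $B$ and asks to SP-lock all its UA-RA transactions ($V.A$ SP-locks $tx$ unless another transaction with this sequence number is SP-locked, in which case the request fails); if all requests succeed, it proposes $B$ to the $k$-th Quorum Consensus of $X$. If there is no such $B$, or a request fails, it collects the transactions that occur in at least $n-2f$ of the received fallback blocks, tries to SP-lock the UA-RA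 transactions among them, and proposes the successfully locked ones together with the collected RA-RA transactions. 5. When $V.X$ decides $B_{qc}$ in Quorum Consensus, for each UA-RA transaction $tx\in B_{qc}$ with sender $A$ the entity $V.A$ tries to SP-lock $tx$ and proposes (unless it proposed before) its SP-locked transaction with number $tx.sn$ to Transaction Agreement number $tx.sn$ of $A$. When all these agreements have decided at $V$, $V.X$ decides $B_{qc}$ without the UA-RA transactions that were not the decided ones. Quorum Consensus and Transaction Agreement are given consensus primitives with Agreement, Termination (if every honest validator proposes in an instance, every honest validator eventually decides in it) and Quorum Validity (a transaction proposed by all honest validators is decided; a decided transaction was proposed by at least $n-3f$ honest validators). A Transaction Agreement instance decides one transaction or none. Apart from this, the behaviour of Byzantine validators, users, and the other parts of the system (which may add transactions to pools, lock transactions at the entities $V.A$ when these are free, propose SP-locked transactions to Transaction Agreement, and execute transactions) is arbitrary. **Theorem (Multi-Termination).** In every execution, for every honest validator $V$, every reactive actor $X$ and every $k\ge 1$, the entity $V.X$ eventually decides a block in the $k$-th instance of POA for $X$. -/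

import Mathlib

namespace Mangrove

/-! ### Transactions -/

section Transactions

/-- What a user transaction does: a UA transaction just runs code, a UA-RA transaction calls a
function of the reactive actor `receiver`, with pre- and post-processing code. -/
inductive UserAction (RA Code : Type*) where
  | run (code : Code)
  | call (receiver : RA) (codePre callData codePost : Code)

/-- Transactions issued by user actors (UA and UA-RA transactions). -/
structure UserTx (UA RA Obj Code Sig : Type*) where
  sender : UA
  sn : ℕ
  consumed : Finset Obj
  action : UserAction RA Code
  signature : Sig

/-- The transaction has a recipient. -/
def UserTx.IsUARA {UA RA Obj Code Sig : Type*} (u : UserTx UA RA Obj Code Sig) : Prop :=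
  ∃ X pre cl post, u.action = UserAction.call X pre cl post

/-- Transactions issued by reactive actors (RA-RA transactions); they have no sequence number. -/
structure ReactiveTx (RA Obj Code : Type*) where
  sender : RA
  receiver : RA
  consumed : Finset Obj
  codePre : Code
  callData : Code
  codePost : Code

inductive Tx (UA RA Obj Code Sig : Type*) where
  | user (u : UserTx UA RA Obj Code Sig)
  | reactive (r : ReactiveTx RA Obj Code)

abbrev Block (UA RA Obj Code Sig : Type*) := Finset (Tx UA RA Obj Code Sig)

/-- The UA-RA transactions of a block. -/
def uaraTxs {UA RA Obj Code Sig : Type*} (B : Block UA RA Obj Code Sig) :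
    Set (UserTx UA RA Obj Code Sig) :=
  {u | u.IsUARA ∧ Tx.user u ∈ B}

end Transactions

/-! ### Parameters of the system -/

/-- The parameters of the system. `byz` is the set of Byzantine validators, `leaderOracle` the
common leader oracle, `verifySig A u` says that `u` carries a correct signature of `A`. -/
structure Setting (Val UA RA Obj Code Sig : Type*) where
  f : ℕ
  p : ℕ
  Δ : ℝ
  GST : ℝ
  byz : Finset Val
  leaderOracle : ℕ → Val
  verifySig : UA → UserTx UA RA Obj Code Sig → Prop

/-- `V` is an honest (non-Byzantine) validator. -/
def Setting.Honest {Val UA RA Obj Code Sig : Type*} (S : Setting Val UA RA Obj Code Sig)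
    (V : Val) : Prop :=
  V ∉ S.byz

/-! ### Messages and local states -/

/-- Messages exchanged over the Outer Links between the entities `V.X`, `V'.X`, ...
All carry the number `k` of the instance. In a `ballot`, the vote `none` is the negative vote.
A `proof` is the aggregate of the votes for `B` of the validators in `signers`. -/
inductive Msg (Val UA RA Obj Code Sig : Type*) where
  | proposal (k : ℕ) (B : Block UA RA Obj Code Sig)
  | ballot (k : ℕ) (vote : Option (Block UA RA Obj Code Sig)) (fallback : Block UA RA Obj Code Sig)
  | proof (k : ℕ) (B : Block UA RA Obj Code Sig) (signers : Finset Val)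

/-- A message sent at time `sentAt` by `src.actor` to `dst.actor`. -/
structure Packet (Val UA RA Obj Code Sig : Type*) where
  src : Val
  dst : Val
  actor : RA
  msg : Msg Val UA RA Obj Code Sig
  sentAt : ℝ

/-- The variables that `V.X` keeps for one instance of POA. -/
structure InstState (Val UA RA Obj Code Sig : Type*) where
  /-- the proposal last received from the leader -/
  block : Option (Block UA RA Obj Code Sig)
  /-- the proposal whose UA-RA transactions are being FP-locked -/
  fpBlock : Option (Block UA RA Obj Code Sig)
  /-- the time since which `V.A` waits for the execution preconditions of a transaction -/
  fpWait : UserTx UA RA Obj Code Sig → Option ℝ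
  /-- the answers to the FP-lock requests -/
  fpReply : UserTx UA RA Obj Code Sig → Option Bool
  voted : Bool
  timedOut : Bool
  /-- the (first) ballot received from each validator: vote and fallback block -/
  votes : Val → Option (Option (Block UA RA Obj Code Sig) × Block UA RA Obj Code Sig)
  /-- the valid proofs received -/
  proofs : Set (Block UA RA Obj Code Sig × Finset Val)
  slowStarted : Bool
  /-- the block with many votes whose UA-RA transactions are being SP-locked -/
  candidate : Option (Block UA RA Obj Code Sig)
  spReply : UserTx UA RA Obj Code Sig → Option Bool
  needFallback : Bool
  /-- the block of transactions that are popular among the fallback blocks -/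
  candidate₂ : Option (Block UA RA Obj Code Sig)
  spReply₂ : UserTx UA RA Obj Code Sig → Option Bool
  /-- the proposal to Quorum Consensus -/
  qcProposal : Option (Block UA RA Obj Code Sig)
  /-- the decision of Quorum Consensus -/
  qcDecision : Option (Block UA RA Obj Code Sig)
  /-- the UA-RA transactions handed over to Transaction Agreement -/
  taRequested : Set (UserTx UA RA Obj Code Sig)
  taReply : UserTx UA RA Obj Code Sig → Option Bool
  /-- the block decided in this instance of POA -/
  decision : Option (Block UA RA Obj Code Sig)

/-- The state of a reactive actor entity `V.X`. `inst` is the number of the current instance,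
`none` before the entity is initialized; `timerStart` is the time of the last timer restart. -/
structure ReactiveState (Val UA RA Obj Code Sig : Type*) where
  inst : Option ℕ
  timerStart : ℝ
  pool : Finset (Tx UA RA Obj Code Sig)
  ins : ℕ → InstState Val UA RA Obj Code Sig

/-- The state of a user actor entity `V.A`. `taProposal sn` and `taDecision sn` are the proposal to
and the decision of the Transaction Agreement instance number `sn` of `A`; the decision `some none`
means that the instance ended without a transaction. -/
structure UserState (UA RA Obj Code Sig : Type*) where
  fpLocked : ℕ → Option (UserTx UA RA Obj Code Sig)
  spLocked : ℕ → Option (UserTx UA RA Obj Code Sig)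
  executed : ℕ → Prop
  owned : Set Obj
  taProposal : ℕ → Option (UserTx UA RA Obj Code Sig)
  taDecision : ℕ → Option (Option (UserTx UA RA Obj Code Sig))

/-- A global configuration: the states of all entities and all messages sent so far. -/
structure Config (Val UA RA Obj Code Sig : Type*) where
  ra : Val → RA → ReactiveState Val UA RA Obj Code Sig
  ua : Val → UA → UserState UA RA Obj Code Sig
  net : Set (Packet Val UA RA Obj Code Sig)

/-! ### Events -/

/-- The events. The events of the first group are the steps of the protocol at `V`. A request from
`V.X` to `V.A` over the Inner Links takes effect when `V.A` handles it; these steps and the local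
computations may take any finite amount of time. -/
inductive Event (Val UA RA Obj Code Sig : Type*) where
  /-- the entity `V.X` is initialized and starts its first instance -/
  | init (V : Val) (X : RA)
  /-- `V.X` asks for FP-locks for the received proposal -/
  | fpStart (V : Val) (X : RA) (k : ℕ)
  /-- `V.A` (`A` the sender of `u`) handles the FP-lock request for `u` -/
  | fpLock (V : Val) (X : RA) (k : ℕ) (u : UserTx UA RA Obj Code Sig)
  /-- `V.A` answers the FP-lock request for `u` after waiting -/
  | fpAnswer (V : Val) (X : RA) (k : ℕ) (u : UserTx UA RA Obj Code Sig) (ok : Bool)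
  /-- all FP-lock requests are answered, `V.X` votes -/
  | vote (V : Val) (X : RA) (k : ℕ)
  /-- the timer of `V.X` exceeds `3Δ`; if no proposal could be considered until then, `V.X`
  broadcasts a negative vote (with its fallback block) -/
  | timeout (V : Val) (X : RA) (k : ℕ)
  /-- `V.X` decides because of enough votes -/
  | fastDecide (V : Val) (X : RA) (k : ℕ) (B : Block UA RA Obj Code Sig)
  /-- `V.X` decides because of a proof -/
  | proofDecide (V : Val) (X : RA) (k : ℕ) (B : Block UA RA Obj Code Sig) (signers : Finset Val)
  /-- `V.X` enters the slow path, with a candidate block or without one -/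
  | slowStart (V : Val) (X : RA) (k : ℕ) (cand : Option (Block UA RA Obj Code Sig))
  /-- `V.A` handles the SP-lock request for a transaction of the candidate block -/
  | spLock (V : Val) (X : RA) (k : ℕ) (u : UserTx UA RA Obj Code Sig)
  /-- all these requests are answered: propose the candidate, or turn to the fallback blocks -/
  | slowPropose (V : Val) (X : RA) (k : ℕ)
  /-- `V.X` collects the transactions that are popular among the fallback blocks -/
  | fbStart (V : Val) (X : RA) (k : ℕ)
  /-- `V.A` handles the SP-lock request for a transaction of this collection -/
  | spLock₂ (V : Val) (X : RA) (k : ℕ) (u : UserTx UA RA Obj Code Sig)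
  /-- all these requests are answered: propose to Quorum Consensus -/
  | fbPropose (V : Val) (X : RA) (k : ℕ)
  /-- `V.A` handles the request to propose to Transaction Agreement -/
  | taRequest (V : Val) (X : RA) (k : ℕ) (u : UserTx UA RA Obj Code Sig)
  /-- `V.A` reports the outcome of Transaction Agreement to `V.X` -/
  | taAnswer (V : Val) (X : RA) (k : ℕ) (u : UserTx UA RA Obj Code Sig)
  /-- all Transaction Agreements have answered, `V.X` decides in the slow path -/
  | slowDecide (V : Val) (X : RA) (k : ℕ)
  -- the network and the two consensus primitives (repeated delivery is harmless and permitted)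
  | deliver (pkt : Packet Val UA RA Obj Code Sig)
  | qcDecide (V : Val) (X : RA) (k : ℕ) (B : Block UA RA Obj Code Sig)
  | taDecide (V : Val) (A : UA) (sn : ℕ) (v : Option (UserTx UA RA Obj Code Sig))
  -- Byzantine validators
  | byzSend (pkt : Packet Val UA RA Obj Code Sig)
  -- The remaining parts of the system (users, broadcast of UA transactions, execution of
  -- transactions). They may act at any time and in any way that the interface permits.
  /-- a transaction enters the pool of `V.X` -/
  | poolAdd (V : Val) (X : RA) (tx : Tx UA RA Obj Code Sig)
  /-- `V.A` FP-locks a transaction received from the user -/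
  | userLock (V : Val) (u : UserTx UA RA Obj Code Sig)
  /-- `V.A` SP-locks a transaction and proposes it to Transaction Agreement, on behalf of the
  broadcast of UA transactions -/
  | pobPropose (V : Val) (u : UserTx UA RA Obj Code Sig)
  /-- the record of executed transactions and owned objects at `V.A` changes -/
  | userUpdate (V : Val) (A : UA) (executed : ℕ → Prop) (owned : Set Obj)

section Protocol

open scoped Classical

variable {Val UA RA Obj Code Sig : Type*}

noncomputable section

/-- The initial variables of an instance. -/
def InstState.initial : InstState Val UA RA Obj Code Sig where
  block := none
  fpBlock := none
  fpWait := fun _ => none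
  fpReply := fun _ => none
  voted := false
  timedOut := false
  votes := fun _ => none
  proofs := ∅
  slowStarted := false
  candidate := none
  spReply := fun _ => none
  needFallback := false
  candidate₂ := none
  spReply₂ := fun _ => none
  qcProposal := none
  qcDecision := none
  taRequested := ∅
  taReply := fun _ => none
  decision := none

/-- Before the start no entity has received, locked, proposed or decided anything. The recorded
executions, owned objects and pools are arbitrary. -/
structure Config.IsInitial (c : Config Val UA RA Obj Code Sig) : Prop where
  inst : ∀ V X, (c.ra V X).inst = none
  ins : ∀ V X k, (c.ra V X).ins k = InstState.initial
  fpLocked : ∀ V A sn, (c.ua V A).fpLocked sn = none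
  spLocked : ∀ V A sn, (c.ua V A).spLocked sn = none
  taProposal : ∀ V A sn, (c.ua V A).taProposal sn = none
  taDecision : ∀ V A sn, (c.ua V A).taDecision sn = none
  net : c.net = ∅

/-- Change the state of `V.X`. -/
def Config.modRA (c : Config Val UA RA Obj Code Sig) (V : Val) (X : RA)
    (g : ReactiveState Val UA RA Obj Code Sig → ReactiveState Val UA RA Obj Code Sig) :
    Config Val UA RA Obj Code Sig :=
  { c with ra := Function.update c.ra V (Function.update (c.ra V) X (g (c.ra V X))) }

/-- Change the variables of instance `k` at `V.X`. -/
def Config.modIns (c : Config Val UA RA Obj Code Sig) (V : Val) (X : RA) (k : ℕ)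
    (g : InstState Val UA RA Obj Code Sig → InstState Val UA RA Obj Code Sig) :
    Config Val UA RA Obj Code Sig :=
  c.modRA V X fun r => { r with ins := Function.update r.ins k (g (r.ins k)) }

/-- Change the state of `V.A`. -/
def Config.modUA (c : Config Val UA RA Obj Code Sig) (V : Val) (A : UA)
    (g : UserState UA RA Obj Code Sig → UserState UA RA Obj Code Sig) :
    Config Val UA RA Obj Code Sig :=
  { c with ua := Function.update c.ua V (Function.update (c.ua V) A (g (c.ua V A))) }

/-- `V.X` sends `m` at time `t` to `V'.X` for all validators `V'`. -/
def Config.broadcast (c : Config Val UA RA Obj Code Sig) (t : ℝ) (V : Val) (X : RA)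
    (m : Msg Val UA RA Obj Code Sig) : Config Val UA RA Obj Code Sig :=
  { c with net := c.net ∪ {pkt | pkt.src = V ∧ pkt.actor = X ∧ pkt.msg = m ∧ pkt.sentAt = t} }

/-- The variables of `V.X` in instance `k`. -/
def Config.at (c : Config Val UA RA Obj Code Sig) (V : Val) (X : RA) (k : ℕ) :
    InstState Val UA RA Obj Code Sig :=
  (c.ra V X).ins k

/-- Start instance `k`: the leader broadcasts its pool, and the timer is restarted. -/
def Config.initiate (S : Setting Val UA RA Obj Code Sig) (t : ℝ)
    (c : Config Val UA RA Obj Code Sig) (V : Val) (X : RA) (k : ℕ) :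
    Config Val UA RA Obj Code Sig :=
  let c' := c.modRA V X fun r => { r with inst := some k, timerStart := t }
  if S.leaderOracle k = V then c'.broadcast t V X (Msg.proposal k (c.ra V X).pool) else c'

/-- Decide `B` in instance `k`: the block is removed from the pool (and executed), then the next
instance is initiated. -/
def Config.decide (S : Setting Val UA RA Obj Code Sig) (t : ℝ)
    (c : Config Val UA RA Obj Code Sig) (V : Val) (X : RA) (k : ℕ)
    (B : Block UA RA Obj Code Sig) : Config Val UA RA Obj Code Sig :=
  ((c.modIns V X k fun s => { s with decision := some B }).modRA V X
    fun r => { r with pool := r.pool \ B }).initiate S t V X (k + 1)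

/-- The validators whose vote for `B` has been received. -/
def InstState.votesFor [Fintype Val] (s : InstState Val UA RA Obj Code Sig)
    (B : Block UA RA Obj Code Sig) : Finset Val :=
  Finset.univ.filter fun U => ∃ fb, s.votes U = some (some B, fb)

/-- The validators from which a (positive or negative) vote has been received. -/
def InstState.voters [Fintype Val] (s : InstState Val UA RA Obj Code Sig) : Finset Val :=
  Finset.univ.filter fun U => s.votes U ≠ none

/-- The fallback block received from `U` (empty if there is none). -/
def InstState.fallbackOf (s : InstState Val UA RA Obj Code Sig) (U : Val) :
    Block UA RA Obj Code Sig :=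
  match s.votes U with
  | some (_, fb) => fb
  | none => ∅

/-- The transactions that are present in at least `m` of the received fallback blocks (`0 < m`). -/
def InstState.popular [Fintype Val] (s : InstState Val UA RA Obj Code Sig) (m : ℕ) :
    Block UA RA Obj Code Sig :=
  (Finset.univ.biUnion s.fallbackOf).filter fun tx =>
    m ≤ (Finset.univ.filter fun U => tx ∈ s.fallbackOf U).card

/-- Verification of a proof for `B` in instance `k` for `X`: there are at least `n - p` signers, and
signatures of honest validators cannot be forged, so those among them have voted for `B`. -/
def ValidProof [Fintype Val] (S : Setting Val UA RA Obj Code Sig)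
    (c : Config Val UA RA Obj Code Sig) (X : RA) (k : ℕ) (B : Block UA RA Obj Code Sig)
    (signers : Finset Val) : Prop :=
  Fintype.card Val - S.p ≤ signers.card ∧
    ∀ U ∈ signers, S.Honest U →
      ∃ pkt ∈ c.net, pkt.src = U ∧ pkt.actor = X ∧ ∃ fb, pkt.msg = Msg.ballot k (some B) fb

/-- `V.A` tries to SP-lock `u`. -/
def UserState.trySPLock (a : UserState UA RA Obj Code Sig) (u : UserTx UA RA Obj Code Sig) :
    UserState UA RA Obj Code Sig :=
  if a.spLocked u.sn = none then
    { a with spLocked := Function.update a.spLocked u.sn (some u) }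
  else a

/-- `V.A` proposes its SP-locked transaction to Transaction Agreement number `sn`, unless it has
proposed there before. -/
def UserState.taPropose (a : UserState UA RA Obj Code Sig) (sn : ℕ) :
    UserState UA RA Obj Code Sig :=
  if a.taProposal sn = none then
    { a with taProposal := Function.update a.taProposal sn (a.spLocked sn) }
  else a

/-- The execution preconditions of `u` hold at `V.A`. -/
def UserState.Ready (a : UserState UA RA Obj Code Sig) (u : UserTx UA RA Obj Code Sig) : Prop :=
  (u.sn = 0 ∨ a.executed (u.sn - 1)) ∧ (u.consumed : Set Obj) ⊆ a.owned

/-- The condition under which an event can happen at time `t` in the configuration `c`. -/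
def Enabled [Fintype Val] (S : Setting Val UA RA Obj Code Sig) (t : ℝ)
    (c : Config Val UA RA Obj Code Sig) : Event Val UA RA Obj Code Sig → Prop
  | .init V X => S.Honest V ∧ (c.ra V X).inst = none
  | .fpStart V X k =>
      S.Honest V ∧ (c.ra V X).inst = some k ∧ t - (c.ra V X).timerStart ≤ 3 * S.Δ ∧
      (c.at V X k).timedOut = false ∧ (c.at V X k).fpBlock = none ∧
      ∃ B, (c.at V X k).block = some B ∧ ∀ r, Tx.reactive r ∈ B → Tx.reactive r ∈ (c.ra V X).pool
  | .fpLock V X k u =>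
      S.Honest V ∧ (∃ B, (c.at V X k).fpBlock = some B ∧ u ∈ uaraTxs B) ∧
      (c.at V X k).fpWait u = none ∧ (c.at V X k).fpReply u = none
  | .fpAnswer V X k u ok =>
      S.Honest V ∧ (c.at V X k).fpReply u = none ∧
      ∃ t₀, (c.at V X k).fpWait u = some t₀ ∧
        ((ok = true ∧ t ≤ t₀ + S.Δ ∧ (c.ua V u.sender).Ready u) ∨ (ok = false ∧ t₀ + S.Δ < t))
  | .vote V X k =>
      S.Honest V ∧ (c.at V X k).voted = false ∧
      ∃ B, (c.at V X k).fpBlock = some B ∧ ∀ u ∈ uaraTxs B, (c.at V X k).fpReply u ≠ none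
  | .timeout V X k =>
      S.Honest V ∧ (c.ra V X).inst = some k ∧ 3 * S.Δ < t - (c.ra V X).timerStart ∧
      (c.at V X k).timedOut = false
  | .fastDecide V X k B =>
      S.Honest V ∧ (c.ra V X).inst = some k ∧
      Fintype.card Val - S.p ≤ ((c.at V X k).votesFor B).card
  | .proofDecide V X k B signers =>
      S.Honest V ∧ (c.ra V X).inst = some k ∧ (B, signers) ∈ (c.at V X k).proofs
  | .slowStart V X k cand =>
      S.Honest V ∧ (c.ra V X).inst = some k ∧ (c.at V X k).timedOut = true ∧
      (c.at V X k).slowStarted = false ∧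
      Fintype.card Val - S.f ≤ (c.at V X k).voters.card ∧
      match cand with
      | some B => Fintype.card Val - S.p - 2 * S.f ≤ ((c.at V X k).votesFor B).card
      | none => ∀ B, ((c.at V X k).votesFor B).card < Fintype.card Val - S.p - 2 * S.f
  | .spLock V X k u =>
      S.Honest V ∧ (∃ B, (c.at V X k).candidate = some B ∧ u ∈ uaraTxs B) ∧
      (c.at V X k).spReply u = none
  | .slowPropose V X k =>
      S.Honest V ∧ (c.at V X k).needFallback = false ∧ (c.at V X k).qcProposal = none ∧
      ∃ B, (c.at V X k).candidate = some B ∧ ∀ u ∈ uaraTxs B, (c.at V X k).spReply u ≠ none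
  | .fbStart V X k =>
      S.Honest V ∧ (c.at V X k).needFallback = true ∧ (c.at V X k).candidate₂ = none
  | .spLock₂ V X k u =>
      S.Honest V ∧ (∃ B, (c.at V X k).candidate₂ = some B ∧ u ∈ uaraTxs B) ∧
      (c.at V X k).spReply₂ u = none
  | .fbPropose V X k =>
      S.Honest V ∧ (c.at V X k).qcProposal = none ∧
      ∃ B, (c.at V X k).candidate₂ = some B ∧ ∀ u ∈ uaraTxs B, (c.at V X k).spReply₂ u ≠ none
  | .taRequest V X k u =>
      S.Honest V ∧ (∃ B, (c.at V X k).qcDecision = some B ∧ u ∈ uaraTxs B) ∧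
      u ∉ (c.at V X k).taRequested
  | .taAnswer V X k u =>
      S.Honest V ∧ u ∈ (c.at V X k).taRequested ∧ (c.at V X k).taReply u = none ∧
      (c.ua V u.sender).taDecision u.sn ≠ none
  | .slowDecide V X k =>
      S.Honest V ∧ (c.ra V X).inst = some k ∧
      ∃ B, (c.at V X k).qcDecision = some B ∧ ∀ u ∈ uaraTxs B, (c.at V X k).taReply u ≠ none
  | .deliver pkt => S.Honest pkt.dst ∧ pkt ∈ c.net
  | .qcDecide V X k _ =>
      S.Honest V ∧ (c.at V X k).qcProposal ≠ none ∧ (c.at V X k).qcDecision = none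
  | .taDecide V A sn _ =>
      S.Honest V ∧ (c.ua V A).taProposal sn ≠ none ∧ (c.ua V A).taDecision sn = none
  | .byzSend pkt => ¬ S.Honest pkt.src ∧ pkt.sentAt = t
  | .poolAdd V _ _ => S.Honest V
  | .userLock V u => S.Honest V ∧ (c.ua V u.sender).fpLocked u.sn = none
  | .pobPropose V u =>
      S.Honest V ∧
      ((c.ua V u.sender).spLocked u.sn = none ∨ (c.ua V u.sender).spLocked u.sn = some u)
  | .userUpdate V _ _ _ => S.Honest V

/-- The configuration after an (enabled) event at time `t` in the configuration `c`. -/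
def effect [Fintype Val] (S : Setting Val UA RA Obj Code Sig) (t : ℝ)
    (c : Config Val UA RA Obj Code Sig) :
    Event Val UA RA Obj Code Sig → Config Val UA RA Obj Code Sig
  | .init V X => c.initiate S t V X 1
  | .fpStart V X k => c.modIns V X k fun s => { s with fpBlock := s.block }
  | .fpLock V X k u =>
      if ¬ S.verifySig u.sender u then
        c.modIns V X k fun s => { s with fpReply := Function.update s.fpReply u (some false) }
      else if (c.ua V u.sender).fpLocked u.sn = none then
        (c.modUA V u.sender fun a =>
          { a with fpLocked := Function.update a.fpLocked u.sn (some u) }).modIns V X k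
            fun s => { s with fpWait := Function.update s.fpWait u (some t) }
      else if (c.ua V u.sender).fpLocked u.sn = some u then
        c.modIns V X k fun s => { s with fpWait := Function.update s.fpWait u (some t) }
      else
        c.modIns V X k fun s => { s with fpReply := Function.update s.fpReply u (some false) }
  | .fpAnswer V X k u ok =>
      c.modIns V X k fun s => { s with fpReply := Function.update s.fpReply u (some ok) }
  | .vote V X k =>
      let ok : Prop := ∃ B, (c.at V X k).fpBlock = some B ∧
        ∀ u ∈ uaraTxs B, (c.at V X k).fpReply u = some true
      (c.modIns V X k fun s => { s with voted := true }).broadcast t V X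
        (Msg.ballot k (if ok then (c.at V X k).fpBlock else none) (c.ra V X).pool)
  | .timeout V X k =>
      if (c.at V X k).fpBlock = none then
        (c.modIns V X k fun s => { s with timedOut := true, voted := true }).broadcast t V X
          (Msg.ballot k none (c.ra V X).pool)
      else
        c.modIns V X k fun s => { s with timedOut := true }
  | .fastDecide V X k B =>
      (c.broadcast t V X (Msg.proof k B ((c.at V X k).votesFor B))).decide S t V X k B
  | .proofDecide V X k B signers =>
      (c.broadcast t V X (Msg.proof k B signers)).decide S t V X k B
  | .slowStart V X k cand =>
      c.modIns V X k fun s =>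
        { s with slowStarted := true, candidate := cand, needFallback := cand.isNone }
  | .spLock V X k u =>
      let a := (c.ua V u.sender).trySPLock u
      (c.modUA V u.sender fun _ => a).modIns V X k fun s =>
        { s with spReply := Function.update s.spReply u (some (decide (a.spLocked u.sn = some u))) }
  | .slowPropose V X k =>
      if ∃ B, (c.at V X k).candidate = some B ∧
          ∀ u ∈ uaraTxs B, (c.at V X k).spReply u = some true then
        c.modIns V X k fun s => { s with qcProposal := s.candidate }
      else
        c.modIns V X k fun s => { s with needFallback := true }
  | .fbStart V X k =>
      c.modIns V X k fun s => { s with candidate₂ := some (s.popular (Fintype.card Val - 2 * S.f)) }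
  | .spLock₂ V X k u =>
      let a := (c.ua V u.sender).trySPLock u
      (c.modUA V u.sender fun _ => a).modIns V X k fun s =>
        { s with
          spReply₂ := Function.update s.spReply₂ u (some (decide (a.spLocked u.sn = some u))) }
  | .fbPropose V X k =>
      c.modIns V X k fun s =>
        { s with qcProposal := s.candidate₂.map fun B => B.filter fun tx =>
            match tx with
            | Tx.user u => u.IsUARA ∧ s.spReply₂ u = some true
            | Tx.reactive _ => True }
  | .taRequest V X k u =>
      (c.modUA V u.sender fun a => (a.trySPLock u).taPropose u.sn).modIns V X k fun s =>
        { s with taRequested := insert u s.taRequested }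
  | .taAnswer V X k u =>
      let ok : Prop := (c.ua V u.sender).taDecision u.sn = some (some u)
      c.modIns V X k fun s => { s with taReply := Function.update s.taReply u (some (decide ok)) }
  | .slowDecide V X k =>
      match (c.at V X k).qcDecision with
      | some B => c.decide S t V X k (B.filter fun tx =>
          match tx with
          | Tx.user u => ¬ (u.IsUARA ∧ (c.at V X k).taReply u = some false)
          | Tx.reactive _ => True)
      | none => c
  | .deliver pkt =>
      match pkt.msg with
      | .proposal k B =>
          if S.leaderOracle k = pkt.src then
            c.modIns pkt.dst pkt.actor k fun s => { s with block := some B }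
          else c
      | .ballot k v fb =>
          if (c.at pkt.dst pkt.actor k).votes pkt.src = none then
            c.modIns pkt.dst pkt.actor k fun s =>
              { s with votes := Function.update s.votes pkt.src (some (v, fb)) }
          else c
      | .proof k B signers =>
          if ValidProof S c pkt.actor k B signers then
            c.modIns pkt.dst pkt.actor k fun s => { s with proofs := insert (B, signers) s.proofs }
          else c
  | .qcDecide V X k B => c.modIns V X k fun s => { s with qcDecision := some B }
  | .taDecide V A sn v =>
      c.modUA V A fun a => { a with taDecision := Function.update a.taDecision sn (some v) }
  | .byzSend pkt => { c with net := insert pkt c.net }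
  | .poolAdd V X tx => c.modRA V X fun r => { r with pool := insert tx r.pool }
  | .userLock V u =>
      c.modUA V u.sender fun a =>
        { a with fpLocked := Function.update a.fpLocked u.sn (some u) }
  | .pobPropose V u => c.modUA V u.sender fun a => (a.trySPLock u).taPropose u.sn
  | .userUpdate V A executed owned =>
      c.modUA V A fun a => { a with executed := executed, owned := owned }

end

/-- The steps of the protocol itself, which an honest validator takes sooner or later. -/
def Event.IsProtocolStep : Event Val UA RA Obj Code Sig → Prop
  | .deliver _ => False
  | .qcDecide _ _ _ _ => False
  | .taDecide _ _ _ _ => False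
  | .byzSend _ => False
  | .poolAdd _ _ _ => False
  | .userLock _ _ => False
  | .pobPropose _ _ => False
  | .userUpdate _ _ _ _ => False
  | _ => True

/-! ### Executions -/

/-- A run: the `i`-th event `ev i` happens at time `time i` in the configuration `cfg i`. -/
structure Run (Val UA RA Obj Code Sig : Type*) where
  cfg : ℕ → Config Val UA RA Obj Code Sig
  ev : ℕ → Event Val UA RA Obj Code Sig
  time : ℕ → ℝ

/-- `V.X` has proposed `B` to the `k`-th Quorum Consensus for `X`. -/
def Run.QCProposes (ρ : Run Val UA RA Obj Code Sig) (V : Val) (X : RA) (k : ℕ)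
    (B : Block UA RA Obj Code Sig) : Prop :=
  ∃ i, ((ρ.cfg i).at V X k).qcProposal = some B

/-- `V.X` has decided `B` in the `k`-th Quorum Consensus for `X`. -/
def Run.QCDecides (ρ : Run Val UA RA Obj Code Sig) (V : Val) (X : RA) (k : ℕ)
    (B : Block UA RA Obj Code Sig) : Prop :=
  ∃ i, ((ρ.cfg i).at V X k).qcDecision = some B

/-- The specification of Quorum Consensus. -/
structure Run.QuorumConsensus [Fintype Val] (S : Setting Val UA RA Obj Code Sig)
    (ρ : Run Val UA RA Obj Code Sig) (X : RA) (k : ℕ) : Prop where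
  agreement : ∀ V W B B', S.Honest V → S.Honest W →
    ρ.QCDecides V X k B → ρ.QCDecides W X k B' → B = B'
  termination : (∀ V, S.Honest V → ∃ B, ρ.QCProposes V X k B) →
    ∀ V, S.Honest V → ∃ B, ρ.QCDecides V X k B
  validity₁ : ∀ tx, (∀ V, S.Honest V → ∃ B, ρ.QCProposes V X k B ∧ tx ∈ B) →
    ∀ V B, S.Honest V → ρ.QCDecides V X k B → tx ∈ B
  validity₂ : ∀ V B, S.Honest V → ρ.QCDecides V X k B → ∀ tx ∈ B,
    Fintype.card Val - 3 * S.f ≤ Set.ncard {W | S.Honest W ∧ ∃ P, ρ.QCProposes W X k P ∧ tx ∈ P}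

/-- `V.A` has proposed `u` to Transaction Agreement number `sn` of `A`. -/
def Run.TAProposes (ρ : Run Val UA RA Obj Code Sig) (V : Val) (A : UA) (sn : ℕ)
    (u : UserTx UA RA Obj Code Sig) : Prop :=
  ∃ i, ((ρ.cfg i).ua V A).taProposal sn = some u

/-- `V.A` has decided `v` in Transaction Agreement number `sn` of `A`. -/
def Run.TADecides (ρ : Run Val UA RA Obj Code Sig) (V : Val) (A : UA) (sn : ℕ)
    (v : Option (UserTx UA RA Obj Code Sig)) : Prop :=
  ∃ i, ((ρ.cfg i).ua V A).taDecision sn = some v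

/-- The specification of Transaction Agreement. -/
structure Run.TransactionAgreement [Fintype Val] (S : Setting Val UA RA Obj Code Sig)
    (ρ : Run Val UA RA Obj Code Sig) (A : UA) (sn : ℕ) : Prop where
  agreement : ∀ V W v v', S.Honest V → S.Honest W →
    ρ.TADecides V A sn v → ρ.TADecides W A sn v' → v = v'
  termination : (∀ V, S.Honest V → ∃ u, ρ.TAProposes V A sn u) →
    ∀ V, S.Honest V → ∃ v, ρ.TADecides V A sn v
  validity₁ : ∀ u, (∀ V, S.Honest V → ρ.TAProposes V A sn u) →
    ∀ V v, S.Honest V → ρ.TADecides V A sn v → v = some u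
  validity₂ : ∀ V u, S.Honest V → ρ.TADecides V A sn (some u) →
    Fintype.card Val - 3 * S.f ≤ Set.ncard {W | S.Honest W ∧ ρ.TAProposes W A sn u}

/-- The executions of the system in the partially synchronous network. -/
structure Run.IsExecution [Fintype Val] (S : Setting Val UA RA Obj Code Sig)
    (ρ : Run Val UA RA Obj Code Sig) : Prop where
  initial : (ρ.cfg 0).IsInitial
  enabled : ∀ i, Enabled S (ρ.time i) (ρ.cfg i) (ρ.ev i)
  step : ∀ i, ρ.cfg (i + 1) = effect S (ρ.time i) (ρ.cfg i) (ρ.ev i)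
  time_nonneg : 0 ≤ ρ.time 0
  time_mono : Monotone ρ.time
  time_unbounded : Filter.Tendsto ρ.time Filter.atTop Filter.atTop
  /-- a protocol step that stays enabled is eventually taken -/
  fair : ∀ e : Event Val UA RA Obj Code Sig, e.IsProtocolStep → ∀ i,
    (∀ j, i ≤ j → Enabled S (ρ.time j) (ρ.cfg j) e) → ∃ j, i ≤ j ∧ ρ.ev j = e
  /-- a message between honest validators that is sent at time `t` is delivered by
  `max (t + Δ) (GST + Δ)` -/
  delivery : ∀ i, ∀ pkt ∈ (ρ.cfg i).net, S.Honest pkt.src → S.Honest pkt.dst →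
    ∃ j, ρ.ev j = Event.deliver pkt ∧ ρ.time j ≤ max (pkt.sentAt + S.Δ) (S.GST + S.Δ)
  quorumConsensus : ∀ X k, ρ.QuorumConsensus S X k
  transactionAgreement : ∀ A sn, ρ.TransactionAgreement S A sn

/-- `V.X` decides the block `B` in the `k`-th instance of POA for `X` (at event number `i`): the
decision is not recorded before the event, and it is recorded after it. -/
def Run.DecidesAt (ρ : Run Val UA RA Obj Code Sig) (V : Val) (X : RA) (k : ℕ)
    (B : Block UA RA Obj Code Sig) (i : ℕ) : Prop :=
  ((ρ.cfg i).at V X k).decision = none ∧ ((ρ.cfg (i + 1)).at V X k).decision = some B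

end Protocol

end Mangrove

namespace Mangrove

variable {Val UA RA Obj Code Sig : Type*}

/-! ### How the operations on configurations act on the single components. -/

section Config

variable (c : Config Val UA RA Obj Code Sig)

/-! The proof is an induction on `k` for all honest validators at once (`exists_inst_eq`). Since a
decision in instance `k` starts instance `k + 1`, it suffices that an instance entered by all honest
validators is decided by each of them (`exists_decidesInst`).

Suppose that an honest `V` never decides in instance `k`; then it stays in it forever. No honest `U`
can have decided there by votes or by a proof: it would have broadcast a proof, which is valid,
stays valid until it is delivered, and would let `V` decide (`exists_proofDecide`). So an honest `U`
that has decided took the slow path; it has therefore proposed to Quorum Consensus and had timed out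
before. An honest `U` that never decides keeps its timer running and times out as well. After a
timeout every honest validator eventually sends a ballot, because waiting FP-lock requests fail
after time `Δ`. Hence ballots from at least `n - f` validators reach everybody, and the undecided
honest validators also enter the slow path and propose. Now all honest validators have proposed, so
Quorum Consensus terminates everywhere, with a common block. They all take part in the Transaction
Agreements for its transactions, these terminate too, and `V` can decide after all.

Two tools carry the details. The variables of an instance only progress (`InstState.Le`), so most
guards persist once they hold, and fairness turns an enabled step into its persistent effect
(`eventually_of_fair`). The invariants `InstState.Coherent` and `InstChange` trace a state back to
the events that must have led to it. -/

@[simp] theorem Config.modRA_ua (V : Val) (X : RA) (g) : (c.modRA V X g).ua = c.ua := rfl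
@[simp] theorem Config.modRA_net (V : Val) (X : RA) (g) : (c.modRA V X g).net = c.net := rfl
@[simp] theorem Config.modIns_ua (V : Val) (X : RA) (k : ℕ) (g) :
    (c.modIns V X k g).ua = c.ua := rfl
@[simp] theorem Config.modIns_net (V : Val) (X : RA) (k : ℕ) (g) :
    (c.modIns V X k g).net = c.net := rfl
@[simp] theorem Config.modUA_ra (V : Val) (A : UA) (g) : (c.modUA V A g).ra = c.ra := rfl
@[simp] theorem Config.broadcast_ra (t : ℝ) (V : Val) (X : RA) (m) :
    (c.broadcast t V X m).ra = c.ra := rfl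
@[simp] theorem Config.broadcast_ua (t : ℝ) (V : Val) (X : RA) (m) :
    (c.broadcast t V X m).ua = c.ua := rfl
@[simp] theorem Config.broadcast_at (t : ℝ) (V : Val) (X : RA) (m) :
    (c.broadcast t V X m).at = c.at := rfl

/-- A disjunction instead of an `if`: one `rcases` separates the modified entity from the others and
supplies the equations of indices. -/
theorem Config.modRA_ra (V : Val) (X : RA) (g) (V' : Val) (X' : RA) :
    (V' = V ∧ X' = X ∧ (c.modRA V X g).ra V' X' = g (c.ra V X)) ∨
    (¬ (V' = V ∧ X' = X) ∧ (c.modRA V X g).ra V' X' = c.ra V' X') := by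
  by_cases h : V' = V
  · subst h
    by_cases h' : X' = X
    · subst h'; simp [Config.modRA]
    · simp [Config.modRA, h']
  · simp [Config.modRA, h]

theorem Config.modUA_ua (V : Val) (A : UA) (g) (V' : Val) (A' : UA) :
    (V' = V ∧ A' = A ∧ (c.modUA V A g).ua V' A' = g (c.ua V A)) ∨
    (¬ (V' = V ∧ A' = A) ∧ (c.modUA V A g).ua V' A' = c.ua V' A') := by
  by_cases h : V' = V
  · subst h
    by_cases h' : A' = A
    · subst h'; simp [Config.modUA]
    · simp [Config.modUA, h']
  · simp [Config.modUA, h]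

theorem Config.modIns_at (V : Val) (X : RA) (k : ℕ) (g) (V' : Val) (X' : RA) (k' : ℕ) :
    (V' = V ∧ X' = X ∧ k' = k ∧ (c.modIns V X k g).at V' X' k' = g (c.at V X k)) ∨
    (¬ (V' = V ∧ X' = X ∧ k' = k) ∧ (c.modIns V X k g).at V' X' k' = c.at V' X' k') := by
  unfold Config.modIns Config.at
  rcases c.modRA_ra V X (fun r => { r with ins := Function.update r.ins k (g (r.ins k)) }) V' X' with
    ⟨h1, h2, h⟩ | ⟨h1, h⟩
  · rw [h]
    by_cases hk : k' = k
    · subst hk; simp [h1, h2]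
    · simp [h1, h2, hk]
  · rw [h]; right; exact ⟨by tauto, rfl⟩

@[simp] theorem Config.modIns_inst (V : Val) (X : RA) (k : ℕ) (g) (V' : Val) (X' : RA) :
    ((c.modIns V X k g).ra V' X').inst = (c.ra V' X').inst := by
  unfold Config.modIns
  rcases c.modRA_ra V X (fun r => { r with ins := Function.update r.ins k (g (r.ins k)) }) V' X' with
    ⟨rfl, rfl, h⟩ | ⟨-, h⟩ <;> rw [h]

@[simp] theorem Config.modIns_timerStart (V : Val) (X : RA) (k : ℕ) (g) (V' : Val) (X' : RA) :
    ((c.modIns V X k g).ra V' X').timerStart = (c.ra V' X').timerStart := by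
  unfold Config.modIns
  rcases c.modRA_ra V X (fun r => { r with ins := Function.update r.ins k (g (r.ins k)) }) V' X' with
    ⟨rfl, rfl, h⟩ | ⟨-, h⟩ <;> rw [h]

theorem Config.modRA_at (V : Val) (X : RA) (g) (hg : ∀ r, (g r).ins = r.ins) :
    (c.modRA V X g).at = c.at := by
  funext V' X' k'
  unfold Config.at
  rcases c.modRA_ra V X g V' X' with ⟨rfl, rfl, h⟩ | ⟨-, h⟩ <;> rw [h]
  rw [hg]

variable (S : Setting Val UA RA Obj Code Sig)

@[simp] theorem Config.initiate_at (t : ℝ) (V : Val) (X : RA) (k : ℕ) :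
    (c.initiate S t V X k).at = c.at := by
  unfold Config.initiate
  dsimp only
  split_ifs
  · exact Config.modRA_at c V X (fun r => { r with inst := some k, timerStart := t }) fun _ => rfl
  · exact Config.modRA_at c V X (fun r => { r with inst := some k, timerStart := t }) fun _ => rfl

@[simp] theorem Config.initiate_ua (t : ℝ) (V : Val) (X : RA) (k : ℕ) :
    (c.initiate S t V X k).ua = c.ua := by
  unfold Config.initiate
  dsimp only
  split_ifs <;> rfl

theorem Config.initiate_ra (t : ℝ) (V : Val) (X : RA) (k : ℕ) :
    (c.initiate S t V X k).ra =
      (c.modRA V X fun r => { r with inst := some k, timerStart := t }).ra := by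
  unfold Config.initiate
  dsimp only
  split_ifs <;> rfl

theorem Config.net_subset_initiate (t : ℝ) (V : Val) (X : RA) (k : ℕ) :
    c.net ⊆ (c.initiate S t V X k).net := by
  unfold Config.initiate
  dsimp only
  split_ifs
  · exact fun _ h => Or.inl h
  · exact fun _ h => h

/-- Starting an instance puts nothing but proposals on the network, so it can be ignored when
ballots or proofs are traced to their origin. -/
theorem Config.mem_initiate_net (t : ℝ) (V : Val) (X : RA) (k : ℕ) (pkt)
    (h : pkt ∈ (c.initiate S t V X k).net) : pkt ∈ c.net ∨ ∃ B, pkt.msg = Msg.proposal k B := by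
  unfold Config.initiate at h
  dsimp only at h
  split_ifs at h
  · exact h.imp id fun h => ⟨_, h.2.2.1⟩
  · exact Or.inl h

@[simp] theorem Config.decide_at (t : ℝ) (V : Val) (X : RA) (k : ℕ) (B) :
    (c.decide S t V X k B).at = (c.modIns V X k fun s => { s with decision := some B }).at := by
  unfold Config.decide
  rw [Config.initiate_at]
  exact Config.modRA_at _ _ _ _ (fun _ => rfl)

@[simp] theorem Config.decide_ua (t : ℝ) (V : Val) (X : RA) (k : ℕ) (B) :
    (c.decide S t V X k B).ua = c.ua := by
  simp [Config.decide]

theorem Config.net_subset_decide (t : ℝ) (V : Val) (X : RA) (k : ℕ) (B) :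
    c.net ⊆ (c.decide S t V X k B).net := by
  unfold Config.decide
  exact fun _ h => Config.net_subset_initiate _ S _ _ _ _ h

theorem Config.mem_decide_net (t : ℝ) (V : Val) (X : RA) (k : ℕ) (B) (pkt)
    (h : pkt ∈ (c.decide S t V X k B).net) :
    pkt ∈ c.net ∨ ∃ B, pkt.msg = Msg.proposal (k + 1) B :=
  by
  unfold Config.decide at h
  simpa using Config.mem_initiate_net _ S _ _ _ _ _ h

theorem Config.initiate_inst (t : ℝ) (V : Val) (X : RA) (k : ℕ) (V' : Val) (X' : RA) :
    (V' = V ∧ X' = X ∧ ((c.initiate S t V X k).ra V' X').inst = some k) ∨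
    (¬ (V' = V ∧ X' = X) ∧
      ((c.initiate S t V X k).ra V' X') = (c.ra V' X')) := by
  rw [Config.initiate_ra]
  rcases c.modRA_ra V X (fun r => { r with inst := some k, timerStart := t }) V' X' with
    ⟨h1, h2, h⟩ | ⟨h1, h⟩
  · exact Or.inl ⟨h1, h2, by rw [h]⟩
  · right; exact ⟨h1, h⟩

theorem Config.decide_inst (t : ℝ) (V : Val) (X : RA) (k : ℕ) (B) (V' : Val) (X' : RA) :
    (V' = V ∧ X' = X ∧ ((c.decide S t V X k B).ra V' X').inst = some (k + 1)) ∨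
    (¬ (V' = V ∧ X' = X) ∧
      ((c.decide S t V X k B).ra V' X').inst = (c.ra V' X').inst ∧
      ((c.decide S t V X k B).ra V' X').timerStart = (c.ra V' X').timerStart) := by
  unfold Config.decide
  rcases Config.initiate_inst (c := Config.modRA _ V X _) S t V X (k + 1) V' X' with h | ⟨h1, h⟩
  · exact Or.inl h
  · right
    refine ⟨h1, ?_⟩
    rw [h]
    rcases Config.modRA_ra (c.modIns V X k fun s => { s with decision := some B }) V X
      _ V' X' with ⟨h2, h3, h⟩ | ⟨h2, h⟩
    · exact absurd ⟨h2, h3⟩ h1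
    · rw [h]; simp

end Config

/-! ### Monotonicity and coherence of the variables of one instance. -/

/-- The variables of an instance only progress. -/
structure InstState.Le (s s' : InstState Val UA RA Obj Code Sig) : Prop where
  fpBlock : ∀ B, s.fpBlock = some B → s'.fpBlock = some B
  fpWait : ∀ u t, s.fpWait u = some t → s'.fpWait u = some t
  fpReply : ∀ u, s.fpReply u ≠ none → s'.fpReply u ≠ none
  voted : s.voted = true → s'.voted = true
  timedOut : s.timedOut = true → s'.timedOut = true
  votes : ∀ U v, s.votes U = some v → s'.votes U = some v
  proofs : s.proofs ⊆ s'.proofs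
  slowStarted : s.slowStarted = true → s'.slowStarted = true
  -- The event `slowStart` overwrites `candidate` and `needFallback`. Only its guard `slowStarted =
  -- false` protects them, whence the extra premise here and in `needFallback`.
  candidate : ∀ B, s.slowStarted = true → s.candidate = some B → s'.candidate = some B
  spReply : ∀ u, s.spReply u ≠ none → s'.spReply u ≠ none
  needFallback : s.slowStarted = true → s.needFallback = true → s'.needFallback = true
  candidate₂ : ∀ B, s.candidate₂ = some B → s'.candidate₂ = some B
  spReply₂ : ∀ u, s.spReply₂ u ≠ none → s'.spReply₂ u ≠ none
  qcProposal : s.qcProposal ≠ none → s'.qcProposal ≠ none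
  qcDecision : ∀ B, s.qcDecision = some B → s'.qcDecision = some B
  taRequested : s.taRequested ⊆ s'.taRequested
  taReply : ∀ u, s.taReply u ≠ none → s'.taReply u ≠ none

theorem InstState.Le.refl (s : InstState Val UA RA Obj Code Sig) : s.Le s := by
  constructor <;> simp

theorem InstState.Le.trans {s s' s'' : InstState Val UA RA Obj Code Sig} (h : s.Le s')
    (h' : s'.Le s'') : s.Le s'' where
  fpBlock B hB := h'.fpBlock B (h.fpBlock B hB)
  fpWait u t hu := h'.fpWait u t (h.fpWait u t hu)
  fpReply u hu := h'.fpReply u (h.fpReply u hu)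
  voted hs := h'.voted (h.voted hs)
  timedOut hs := h'.timedOut (h.timedOut hs)
  votes U v hv := h'.votes U v (h.votes U v hv)
  proofs := h.proofs.trans h'.proofs
  slowStarted hs := h'.slowStarted (h.slowStarted hs)
  candidate B hs hB := h'.candidate B (h.slowStarted hs) (h.candidate B hs hB)
  spReply u hu := h'.spReply u (h.spReply u hu)
  needFallback hs hn := h'.needFallback (h.slowStarted hs) (h.needFallback hs hn)
  candidate₂ B hB := h'.candidate₂ B (h.candidate₂ B hB)
  spReply₂ u hu := h'.spReply₂ u (h.spReply₂ u hu)
  qcProposal hq := h'.qcProposal (h.qcProposal hq)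
  qcDecision B hB := h'.qcDecision B (h.qcDecision B hB)
  taRequested := h.taRequested.trans h'.taRequested
  taReply u hu := h'.taReply u (h.taReply u hu)

/-- The dependencies between the variables of an instance. -/
structure InstState.Coherent (s : InstState Val UA RA Obj Code Sig) : Prop where
  timedOut : s.timedOut = true → s.fpBlock ≠ none ∨ s.voted = true
  slowStarted : s.slowStarted = true → s.timedOut = true
  split : s.slowStarted = true → s.candidate ≠ none ∨ s.needFallback = true
  -- This and the next two fields make `qcProposal` inductive: a proposal is a copy of `candidate`
  -- or is filtered from `candidate₂`, and the latter is collected only when `needFallback` holds.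
  candidate : s.candidate ≠ none → s.slowStarted = true
  needFallback : s.needFallback = true → s.slowStarted = true
  candidate₂ : s.candidate₂ ≠ none → s.slowStarted = true
  qcProposal : s.qcProposal ≠ none → s.slowStarted = true
  qcDecision : s.qcDecision ≠ none → s.qcProposal ≠ none

theorem InstState.coherent_initial :
    (InstState.initial : InstState Val UA RA Obj Code Sig).Coherent := by
  constructor <;> simp [InstState.initial]

/-- A reflexive relation between instance states that holds for a modification holds for all
instance states before and after it. -/
theorem Config.modIns_at_rel {c c₀ : Config Val UA RA Obj Code Sig} (hc : c.at = c₀.at)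
    {V : Val} {X : RA} {k : ℕ} {g}
    {R : InstState Val UA RA Obj Code Sig → InstState Val UA RA Obj Code Sig → Prop}
    (V' : Val) (X' : RA) (k' : ℕ) (hR : ∀ s, R s s) (hg : R (c₀.at V X k) (g (c₀.at V X k))) :
    R (c₀.at V' X' k') ((c.modIns V X k g).at V' X' k') := by
  rcases c.modIns_at V X k g V' X' k' with ⟨rfl, rfl, rfl, h⟩ | ⟨-, h⟩ <;> rw [h, hc]
  · exact hg
  · exact hR _

section Step

variable [Fintype Val] {S : Setting Val UA RA Obj Code Sig} {t : ℝ}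
  {c : Config Val UA RA Obj Code Sig} {e : Event Val UA RA Obj Code Sig}

set_option maxHeartbeats 2000000 in
open scoped Classical in
theorem effect_at (h : Enabled S t c e) (V : Val) (X : RA) (k : ℕ) :
    (c.at V X k).Le ((effect S t c e).at V X k) ∧
      ((c.at V X k).Coherent → ((effect S t c e).at V X k).Coherent) := by
  have hR : ∀ s : InstState Val UA RA Obj Code Sig, s.Le s ∧ (s.Coherent → s.Coherent) :=
    fun s => ⟨.refl s, id⟩
  cases e <;> simp only [effect, Enabled, Config.decide_at, Config.initiate_at,
    Config.broadcast_at] at h ⊢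
  -- The `match` in this effect is resolved by the guard, which provides the block decided by Quorum
  -- Consensus.
  case slowDecide V' X' k' => 
    obtain ⟨-, -, B, h, -⟩ := h
    simp only [h, Config.decide_at]
    refine Config.modIns_at_rel (c₀ := c) (R := fun s s' => s.Le s' ∧ (s.Coherent → s'.Coherent))
      ?_ V X k hR (And.intro ?_ ?_)
    · rfl
    · constructor <;> first | exact id | exact fun _ => id | exact fun _ _ => id
    · exact fun ⟨h1, h2, h3, h4, h5, h6, h7, h8⟩ => ⟨h1, h2, h3, h4, h5, h6, h7, h8⟩
  case poolAdd V' X' tx =>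
    rw [Config.modRA_at c V' X' (fun r => { r with pool := insert tx r.pool }) fun _ => rfl]
    exact hR _
  -- Conditionals are nested at most three deep, in `fpLock`.
  all_goals try split
  all_goals try split
  all_goals try split
  all_goals try simp only [Config.broadcast_at]
  all_goals try exact hR _
  all_goals
    refine Config.modIns_at_rel (c₀ := c) (R := fun s s' => s.Le s' ∧ (s.Coherent → s'.Coherent))
      ?_ V X k hR (And.intro ?_ ?_)
  all_goals try exact rfl
  all_goals try exact
    (fun ⟨h1, h2, h3, h4, h5, h6, h7, h8⟩ => ⟨h1, h2, h3, h4, h5, h6, h7, h8⟩)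
  all_goals try
    constructor <;> first | exact id | exact fun _ => id | exact fun _ _ => id | skip
  all_goals try grind [Function.update_apply]
  all_goals try (rintro ⟨h1, h2, h3, h4, h5, h6, h7, h8⟩; constructor <;> grind)

end Step

/-- The unary counterpart of `modIns_at_rel`. The configuration `c` may differ from `c₀` outside the
instance variables, which covers events that also act on user entities. The equations in `hg` let
`P` mention the indices. -/
theorem Config.modIns_at_ind {c c₀ : Config Val UA RA Obj Code Sig} (hc : c.at = c₀.at)
    {V : Val} {X : RA} {k : ℕ} {g} {P : InstState Val UA RA Obj Code Sig → Prop}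
    (V' : Val) (X' : RA) (k' : ℕ) (h₀ : P (c₀.at V' X' k'))
    (hg : V' = V → X' = X → k' = k → P (g (c₀.at V X k))) :
    P ((c.modIns V X k g).at V' X' k') := by
  rcases c.modIns_at V X k g V' X' k' with ⟨h1, h2, h3, h⟩ | ⟨-, h⟩ <;> rw [h, hc]
  · exact hg h1 h2 h3
  · exact h₀

/-! ### What a single event can change, and what must have caused a change. -/

/-- The event decides in instance `k` at `V.X`. -/
def Event.DecidesInst (e : Event Val UA RA Obj Code Sig) (V : Val) (X : RA) (k : ℕ) : Prop :=
  (∃ B, e = .fastDecide V X k B) ∨ (∃ B s, e = .proofDecide V X k B s) ∨ e = .slowDecide V X k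

/-- How the variables of an instance that are tied to the rest of the configuration can change to
those of `s'` in an event. -/
structure InstChange [Fintype Val] (S : Setting Val UA RA Obj Code Sig)
    (c : Config Val UA RA Obj Code Sig) (e : Event Val UA RA Obj Code Sig) (V : Val) (X : RA)
    (k : ℕ) (s' : InstState Val UA RA Obj Code Sig) : Prop where
  voted : s'.voted = true → (c.at V X k).voted = true ∨ e = .vote V X k ∨
    (e = .timeout V X k ∧ (c.at V X k).fpBlock = none)
  votes : ∀ U B fb, s'.votes U = some (some B, fb) → (c.at V X k).votes U = some (some B, fb) ∨
    ∃ pkt ∈ c.net, pkt.src = U ∧ pkt.actor = X ∧ pkt.msg = .ballot k (some B) fb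
  proofs : ∀ B s, (B, s) ∈ s'.proofs → (B, s) ∈ (c.at V X k).proofs ∨ ValidProof S c X k B s
  taRequested : ∀ u, u ∈ s'.taRequested → u ∈ (c.at V X k).taRequested ∨ e = .taRequest V X k u
  decision : s'.decision = (c.at V X k).decision ∨ e.DecidesInst V X k

section Step

variable [Fintype Val] {S : Setting Val UA RA Obj Code Sig} {t : ℝ}
  {c : Config Val UA RA Obj Code Sig} {e : Event Val UA RA Obj Code Sig}

theorem InstChange.refl (V : Val) (X : RA) (k : ℕ) : InstChange S c e V X k (c.at V X k) := by
  constructor <;> tauto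

set_option maxHeartbeats 2000000 in
open scoped Classical in
theorem instChange_effect (h : Enabled S t c e) (V : Val) (X : RA) (k : ℕ) :
    InstChange S c e V X k ((effect S t c e).at V X k) := by
  have hR : InstChange S c e V X k (c.at V X k) := .refl V X k
  cases e <;> simp only [effect, Enabled, Config.decide_at, Config.initiate_at,
    Config.broadcast_at] at h ⊢
  case slowDecide V' X' k' =>
    obtain ⟨-, -, B, h, -⟩ := h
    simp only [h, Config.decide_at]
    refine Config.modIns_at_ind (c₀ := c) ?_ V X k hR ?_
    · rfl
    · rintro rfl rfl rfl
      obtain ⟨h1, h2, h3, h4, h5⟩ := hR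
      exact ⟨h1, h2, h3, h4, Or.inr (Or.inr (Or.inr rfl))⟩
  case poolAdd V' X' tx =>
    rw [Config.modRA_at c V' X' (fun r => { r with pool := insert tx r.pool }) fun _ => rfl]
    exact hR
  all_goals try split
  all_goals try split
  all_goals try split
  all_goals try simp only [Config.broadcast_at]
  all_goals try exact hR
  all_goals
    refine Config.modIns_at_ind (c₀ := c) (P := InstChange S c _ V X k) ?_ V X k hR ?_
  all_goals try exact rfl
  all_goals
    rintro rfl rfl rfl
    obtain ⟨h1, h2, h3, h4, h5⟩ := hR
    try exact ⟨h1, h2, h3, h4, h5⟩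
  case vote => exact ⟨fun _ => Or.inr (Or.inl rfl), h2, h3, h4, h5⟩
  case timeout.isTrue h' => exact ⟨fun _ => Or.inr (Or.inr ⟨rfl, h'⟩), h2, h3, h4, h5⟩
  case fastDecide => exact ⟨h1, h2, h3, h4, Or.inr (Or.inl ⟨_, rfl⟩)⟩
  case proofDecide => exact ⟨h1, h2, h3, h4, Or.inr (Or.inr (Or.inl ⟨_, _, rfl⟩))⟩
  case taRequest u =>
    refine ⟨h1, h2, h3, fun u' hu => ?_, h5⟩
    rcases hu with rfl | hu
    · exact Or.inr rfl
    · exact Or.inl hu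
  -- Delivery of a ballot: a vote is either old or that of the delivered packet, which the guard
  -- places in the network.
  · refine ⟨h1, fun U B fb' hU => ?_, h3, h4, h5⟩
    grind [Function.update_apply]
  -- Delivery of a proof: it is recorded only after verification.
  · refine ⟨h1, h2, fun B' s' hB => ?_, h4, h5⟩
    rcases hB with hB | hB
    · grind
    · exact Or.inl hB

open scoped Classical in
theorem net_subset_effect (S : Setting Val UA RA Obj Code Sig) (t : ℝ)
    (c : Config Val UA RA Obj Code Sig) (e : Event Val UA RA Obj Code Sig) :
    c.net ⊆ (effect S t c e).net := by
  cases e <;> simp only [effect]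
  case init => exact c.net_subset_initiate S _ _ _ _
  case byzSend => exact fun _ => Set.mem_insert_of_mem _
  case fastDecide V X k B =>
    exact fun _ h => Config.net_subset_decide _ S _ _ _ _ _ (Or.inl h)
  case proofDecide V X k B =>
    exact fun _ h => Config.net_subset_decide _ S _ _ _ _ _ (Or.inl h)
  case slowDecide V X k =>
    split
    · exact Config.net_subset_decide _ S _ _ _ _ _
    · exact fun _ h => h
  all_goals try split
  all_goals try split
  all_goals try split
  all_goals try exact fun _ h => h
  all_goals exact fun _ h => Or.inl h

open scoped Classical in
/-- Honest validators send proofs only when they decide. -/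
theorem proof_mem_effect_net (h : Enabled S t c e) {pkt : Packet Val UA RA Obj Code Sig}
    {k : ℕ} {B} {s} (hpkt : pkt ∈ (effect S t c e).net) (hsrc : S.Honest pkt.src)
    (hmsg : pkt.msg = .proof k B s) :
    pkt ∈ c.net ∨ (e = .fastDecide pkt.src pkt.actor k B ∧
      s = (c.at pkt.src pkt.actor k).votesFor B) ∨ e = .proofDecide pkt.src pkt.actor k B s := by
  cases e <;> simp only [effect] at hpkt
  case init =>
    rcases c.mem_initiate_net S _ _ _ _ _ hpkt with h | ⟨_, h⟩
    · exact Or.inl h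
    · simp [h] at hmsg
  case byzSend =>
    rcases hpkt with rfl | hpkt
    · exact absurd hsrc h.1
    · exact Or.inl hpkt
  case fastDecide V X k' B' =>
    rcases Config.mem_decide_net _ S _ _ _ _ _ _ hpkt with (h | h) | ⟨_, h⟩
    · exact Or.inl h
    · obtain ⟨rfl, rfl, h, -⟩ := h
      rw [hmsg] at h
      injection h with h1 h2 h3
      subst h1 h2 h3
      exact Or.inr (Or.inl ⟨rfl, rfl⟩)
    · simp [h] at hmsg
  case proofDecide V X k' B' s' =>
    rcases Config.mem_decide_net _ S _ _ _ _ _ _ hpkt with (h | h) | ⟨_, h⟩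
    · exact Or.inl h
    · obtain ⟨rfl, rfl, h, -⟩ := h
      rw [hmsg] at h
      injection h with h1 h2 h3
      subst h1 h2 h3
      exact Or.inr (Or.inr rfl)
    · simp [h] at hmsg
  case slowDecide V X k =>
    split at hpkt
    · rcases Config.mem_decide_net _ S _ _ _ _ _ _ hpkt with h | ⟨_, h⟩
      · exact Or.inl h
      · simp [h] at hmsg
    · exact Or.inl hpkt
  all_goals try split at hpkt
  all_goals try split at hpkt
  all_goals try split at hpkt
  all_goals try exact Or.inl hpkt
  -- The broadcasts that remain are ballots, from `vote` and `timeout`.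
  all_goals
    rcases hpkt with h | ⟨-, -, h, -⟩
    · exact Or.inl h
    · simp [h] at hmsg

open scoped Classical in
-- The timer is restarted only together with a change of instance, so an entity that stays in its
-- instance keeps its timer.
theorem effect_inst (h : Enabled S t c e) (V : Val) (X : RA) :
    (((effect S t c e).ra V X).inst = (c.ra V X).inst ∧
      ((effect S t c e).ra V X).timerStart = (c.ra V X).timerStart) ∨
    (e = .init V X ∧ (c.ra V X).inst = none ∧ ((effect S t c e).ra V X).inst = some 1) ∨
    ∃ k, e.DecidesInst V X k ∧ (c.ra V X).inst = some k ∧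
      ((effect S t c e).ra V X).inst = some (k + 1) := by
  cases e <;> simp only [effect]
  case init V' X' =>
    rcases c.initiate_inst S t V' X' 1 V X with ⟨rfl, rfl, hi⟩ | ⟨-, hi⟩
    · exact Or.inr (Or.inl ⟨rfl, h.2, hi⟩)
    · exact Or.inl (by rw [hi]; exact ⟨rfl, rfl⟩)
  case fastDecide V' X' k B =>
    rcases Config.decide_inst (c.broadcast t V' X' (.proof k B ((c.at V' X' k).votesFor B)))
      S t V' X' k B V X with ⟨rfl, rfl, hi⟩ | ⟨-, hi⟩
    · exact Or.inr (Or.inr ⟨k, Or.inl ⟨_, rfl⟩, h.2.1, hi⟩)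
    · exact Or.inl hi
  case proofDecide V' X' k B s =>
    rcases Config.decide_inst (c.broadcast t V' X' (.proof k B s))
      S t V' X' k B V X with ⟨rfl, rfl, hi⟩ | ⟨-, hi⟩
    · exact Or.inr (Or.inr ⟨k, Or.inr (Or.inl ⟨_, _, rfl⟩), h.2.1, hi⟩)
    · exact Or.inl hi
  case slowDecide V' X' k =>
    obtain ⟨-, h1, B, h2, -⟩ := h
    simp only [h2]
    rcases Config.decide_inst c S t V' X' k (B.filter fun tx =>
          match tx with
          | Tx.user u => ¬ (u.IsUARA ∧ (c.at V' X' k).taReply u = some false)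
          | Tx.reactive _ => True) V X with ⟨rfl, rfl, hi⟩ | ⟨-, hi⟩
    · exact Or.inr (Or.inr ⟨k, Or.inr (Or.inr rfl), h1, hi⟩)
    · exact Or.inl hi
  case poolAdd V' X' tx =>
    left
    rcases c.modRA_ra V' X' (fun r => { r with pool := insert tx r.pool }) V X with
      ⟨rfl, rfl, hi⟩ | ⟨-, hi⟩ <;> rw [hi] <;>
      exact ⟨rfl, rfl⟩
  all_goals
    left
    try split
    all_goals try split
    all_goals try split
    all_goals simp

theorem Event.DecidesInst.effect_decision {V : Val} {X : RA} {k : ℕ} (he : e.DecidesInst V X k)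
    (h : Enabled S t c e) : ∃ B, ((effect S t c e).at V X k).decision = some B := by
  have key : ∀ (c' : Config Val UA RA Obj Code Sig) B, ((c'.modIns V X k fun s =>
      { s with decision := some B }).at V X k).decision = some B := by
    intro c' B
    rcases c'.modIns_at V X k (fun s => { s with decision := some B }) V X k with
      ⟨-, -, -, h⟩ | ⟨h, -⟩
    · rw [h]
    · simp at h
  rcases he with ⟨B, rfl⟩ | ⟨B, s, rfl⟩ | rfl <;> simp only [effect, Config.decide_at, key]
  · exact ⟨_, rfl⟩
  · exact ⟨_, rfl⟩
  · obtain ⟨-, -, B, h, -⟩ := h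
    simp only [h, Config.decide_at, key]
    exact ⟨_, rfl⟩

open scoped Classical in
theorem ballot_mem_effect_net {V : Val} {X : RA} {k : ℕ}
    (he : e = .vote V X k ∨ e = .timeout V X k ∧ (c.at V X k).fpBlock = none) :
    ∃ v fb, ∀ U, ⟨V, U, X, .ballot k v fb, t⟩ ∈ (effect S t c e).net := by
  rcases he with rfl | ⟨rfl, h⟩
  · exact ⟨_, _, fun U => Or.inr ⟨rfl, rfl, rfl, rfl⟩⟩
  · simp only [effect, h, if_true]
    exact ⟨_, _, fun U => Or.inr ⟨rfl, rfl, rfl, rfl⟩⟩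

theorem fastDecide_proof_mem_net (V U : Val) (X : RA) (k : ℕ) (B : Block UA RA Obj Code Sig) :
    ⟨V, U, X, .proof k B ((c.at V X k).votesFor B), t⟩ ∈
      (effect S t c (.fastDecide V X k B)).net :=
  Config.net_subset_decide _ S _ _ _ _ _ (Or.inr ⟨rfl, rfl, rfl, rfl⟩)

theorem proofDecide_proof_mem_net (V U : Val) (X : RA) (k : ℕ) (B : Block UA RA Obj Code Sig)
    (s : Finset Val) :
    ⟨V, U, X, .proof k B s, t⟩ ∈ (effect S t c (.proofDecide V X k B s)).net :=
  Config.net_subset_decide _ S _ _ _ _ _ (Or.inr ⟨rfl, rfl, rfl, rfl⟩)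

/-! ### Persistence of proposals and decisions of Transaction Agreement. -/

/-- Either the number was free and `u` is locked now, or some transaction was locked before. In both
cases there is something to propose to Transaction Agreement, not necessarily `u`; termination asks
for no more. -/
theorem UserState.trySPLock_spLocked (a : UserState UA RA Obj Code Sig)
    (u : UserTx UA RA Obj Code Sig) : (a.trySPLock u).spLocked u.sn ≠ none := by
  unfold UserState.trySPLock
  split_ifs with h
  · simp
  · exact h

theorem UserState.taPropose_taProposal (a : UserState UA RA Obj Code Sig) (sn : ℕ)
    (h : a.spLocked sn ≠ none) : (a.taPropose sn).taProposal sn ≠ none := by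
  unfold UserState.taPropose
  split_ifs with h'
  · simpa using h
  · exact h'

theorem UserState.taPropose_taProposal_mono (a : UserState UA RA Obj Code Sig) (sn sn' : ℕ)
    (h : a.taProposal sn' ≠ none) : (a.taPropose sn).taProposal sn' ≠ none := by
  unfold UserState.taPropose
  split_ifs with h'
  · have : sn' ≠ sn := fun h'' => h (h'' ▸ h')
    simpa [this] using h
  · exact h

@[simp] theorem UserState.trySPLock_taProposal (a : UserState UA RA Obj Code Sig)
    (u : UserTx UA RA Obj Code Sig) : (a.trySPLock u).taProposal = a.taProposal := by
  unfold UserState.trySPLock; split_ifs <;> rfl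

@[simp] theorem UserState.trySPLock_taDecision (a : UserState UA RA Obj Code Sig)
    (u : UserTx UA RA Obj Code Sig) : (a.trySPLock u).taDecision = a.taDecision := by
  unfold UserState.trySPLock; split_ifs <;> rfl

@[simp] theorem UserState.taPropose_taDecision (a : UserState UA RA Obj Code Sig)
    (sn : ℕ) : (a.taPropose sn).taDecision = a.taDecision := by
  unfold UserState.taPropose; split_ifs <;> rfl

open scoped Classical in
-- Only the existence of proposals and decisions is followed, not their values. No guard is needed:
-- `taPropose` never overwrites, and `taDecide` always writes a decision.
theorem effect_ua (S : Setting Val UA RA Obj Code Sig) (t : ℝ)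
    (c : Config Val UA RA Obj Code Sig) (e : Event Val UA RA Obj Code Sig)
    (V : Val) (A : UA) (sn : ℕ) :
    ((c.ua V A).taProposal sn ≠ none → ((effect S t c e).ua V A).taProposal sn ≠ none) ∧
    ((c.ua V A).taDecision sn ≠ none → ((effect S t c e).ua V A).taDecision sn ≠ none) := by
  have key : ∀ (V' : Val) (A' : UA) (g : UserState UA RA Obj Code Sig → UserState UA RA Obj Code Sig),
      (((c.ua V' A').taProposal sn ≠ none → (g (c.ua V' A')).taProposal sn ≠ none) ∧
        ((c.ua V' A').taDecision sn ≠ none → (g (c.ua V' A')).taDecision sn ≠ none)) →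
      ((c.ua V A).taProposal sn ≠ none → ((c.modUA V' A' g).ua V A).taProposal sn ≠ none) ∧
      ((c.ua V A).taDecision sn ≠ none → ((c.modUA V' A' g).ua V A).taDecision sn ≠ none) := by
    intro V' A' g hg
    rcases c.modUA_ua V' A' g V A with ⟨rfl, rfl, h⟩ | ⟨-, h⟩ <;> rw [h]
    · exact hg
    · exact ⟨id, id⟩
  cases e <;> simp only [effect]
  case slowDecide => split <;> simp
  all_goals try split
  all_goals try split
  all_goals try split
  all_goals try simp only [Config.modIns_ua, Config.broadcast_ua, Config.modRA_ua, Config.decide_ua,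
    Config.initiate_ua]
  all_goals try exact ⟨id, id⟩
  all_goals
    refine key _ _ _ ?_
    try simp only [UserState.trySPLock_taProposal, UserState.trySPLock_taDecision,
      UserState.taPropose_taDecision]
    try exact ⟨id, id⟩
  case taRequest => exact ⟨fun h => UserState.taPropose_taProposal_mono _ _ _ (by simpa), id⟩
  case pobPropose => exact ⟨fun h => UserState.taPropose_taProposal_mono _ _ _ (by simpa), id⟩
  case taDecide sn' _ =>
    refine ⟨id, fun h => ?_⟩
    by_cases h' : sn = sn'
    · simp [h']
    · simpa [h'] using h

theorem effect_taRequest (V : Val) (X : RA) (k : ℕ) (u : UserTx UA RA Obj Code Sig) :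
    ((effect S t c (.taRequest V X k u)).ua V u.sender).taProposal u.sn ≠ none := by
  simp only [effect, Config.modIns_ua]
  rcases c.modUA_ua V u.sender (fun a => (a.trySPLock u).taPropose u.sn) V u.sender with
    ⟨-, -, h⟩ | ⟨h, -⟩
  · rw [h]
    exact UserState.taPropose_taProposal _ _ (UserState.trySPLock_spLocked _ _)
  · simp at h

/-- Validity only asks for ballots in the network, and the network forgets nothing; so a proof that
was valid when sent is still valid when delivered. -/
theorem ValidProof.mono {c c' : Config Val UA RA Obj Code Sig} {X : RA} {k : ℕ}
    {B : Block UA RA Obj Code Sig} {s : Finset Val} (h : ValidProof S c X k B s)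
    (hc : c.net ⊆ c'.net) : ValidProof S c' X k B s :=
  ⟨h.1, fun U hU hh => let ⟨pkt, hp, h⟩ := h.2 U hU hh; ⟨pkt, hc hp, h⟩⟩

end Step

/-! ### The intended effect of each protocol step. -/

@[simp] theorem Config.modIns_at_self (c : Config Val UA RA Obj Code Sig) (V : Val) (X : RA)
    (k : ℕ) (g) : (c.modIns V X k g).at V X k = g (c.at V X k) := by
  rcases c.modIns_at V X k g V X k with ⟨-, -, -, h⟩ | ⟨h, -⟩
  · exact h
  · simp at h

theorem InstState.mem_votesFor [Fintype Val] {s : InstState Val UA RA Obj Code Sig}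
    {B : Block UA RA Obj Code Sig} {U : Val} :
    U ∈ s.votesFor B ↔ ∃ fb, s.votes U = some (some B, fb) := by
  simp [InstState.votesFor]

section Step

variable [Fintype Val] {S : Setting Val UA RA Obj Code Sig} {t : ℝ}
  {c : Config Val UA RA Obj Code Sig} {e : Event Val UA RA Obj Code Sig}

theorem Event.DecidesInst.inst_eq {V : Val} {X : RA} {k : ℕ} (he : e.DecidesInst V X k)
    (h : Enabled S t c e) : (c.ra V X).inst = some k := by
  rcases he with ⟨B, rfl⟩ | ⟨B, s, rfl⟩ | rfl <;> exact h.2.1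

theorem Event.DecidesInst.effect_inst {V : Val} {X : RA} {k : ℕ} (he : e.DecidesInst V X k)
    (h : Enabled S t c e) : ((effect S t c e).ra V X).inst = some (k + 1) := by
  have key : ∀ (c' : Config Val UA RA Obj Code Sig) B,
      ((c'.decide S t V X k B).ra V X).inst = some (k + 1) := by
    intro c' B
    rcases c'.decide_inst S t V X k B V X with ⟨-, -, h⟩ | ⟨h, -⟩
    · exact h
    · simp at h
  rcases he with ⟨B, rfl⟩ | ⟨B, s, rfl⟩ | rfl
  · exact key _ _
  · exact key _ _
  · obtain ⟨-, -, B, h, -⟩ := h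
    simp only [effect, h, key]

theorem effect_deliver_ballot {pkt : Packet Val UA RA Obj Code Sig} {k : ℕ} {v fb}
    (h : pkt.msg = .ballot k v fb) :
    ((effect S t c (.deliver pkt)).at pkt.dst pkt.actor k).votes pkt.src ≠ none := by
  simp only [effect, h]
  split_ifs with h'
  · simp
  · exact h'

theorem effect_deliver_proof {pkt : Packet Val UA RA Obj Code Sig} {k : ℕ} {B s}
    (h : pkt.msg = .proof k B s) (hv : ValidProof S c pkt.actor k B s) :
    (B, s) ∈ ((effect S t c (.deliver pkt)).at pkt.dst pkt.actor k).proofs := by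
  simp only [effect, h]
  rw [if_pos hv]
  simp

theorem effect_fpLock (V : Val) (X : RA) (k : ℕ) (u : UserTx UA RA Obj Code Sig) :
    ((effect S t c (.fpLock V X k u)).at V X k).fpWait u ≠ none ∨
      ((effect S t c (.fpLock V X k u)).at V X k).fpReply u ≠ none := by
  simp only [effect]
  split_ifs <;> simp

theorem effect_timeout (V : Val) (X : RA) (k : ℕ) :
    ((effect S t c (.timeout V X k)).at V X k).timedOut = true := by
  simp only [effect]
  split_ifs <;> simp

theorem effect_slowPropose (V : Val) (X : RA) (k : ℕ) :
    ((effect S t c (.slowPropose V X k)).at V X k).qcProposal ≠ none ∨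
      ((effect S t c (.slowPropose V X k)).at V X k).needFallback = true := by
  simp only [effect]
  split_ifs with h
  · obtain ⟨B, h, -⟩ := h
    simp [h]
  · simp

theorem effect_fbPropose (V : Val) (X : RA) (k : ℕ) (h : Enabled S t c (.fbPropose V X k)) :
    ((effect S t c (.fbPropose V X k)).at V X k).qcProposal ≠ none := by
  obtain ⟨-, -, B, h, -⟩ := h
  simp [effect, h]

/-- Finiteness allows exchanging "for all transactions of the block" with "from some moment on", so
that requests answered one by one are eventually all answered. -/
theorem uaraTxs_finite (B : Block UA RA Obj Code Sig) : (uaraTxs B).Finite := by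
  refine Set.Finite.subset (B.finite_toSet.preimage (f := Tx.user) ?_) fun u hu => hu.2
  intro a _ b _ hab
  injection hab

end Step

namespace Run.IsExecution

open Filter

variable [Fintype Val] {S : Setting Val UA RA Obj Code Sig} {ρ : Run Val UA RA Obj Code Sig}

/-! ### Safety -/

theorem at_mono (h : ρ.IsExecution S) (V : Val) (X : RA) (k : ℕ) {i j : ℕ} (hij : i ≤ j) :
    ((ρ.cfg i).at V X k).Le ((ρ.cfg j).at V X k) := by
  induction j, hij using Nat.le_induction with
  | base => exact .refl _
  | succ j _ ih => rw [h.step]; exact ih.trans (effect_at (h.enabled j) V X k).1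

theorem coherent (h : ρ.IsExecution S) (V : Val) (X : RA) (k i : ℕ) :
    ((ρ.cfg i).at V X k).Coherent := by
  induction i with
  | zero => unfold Config.at; rw [h.initial.ins]; exact InstState.coherent_initial
  | succ i ih => rw [h.step]; exact (effect_at (h.enabled i) V X k).2 ih

theorem net_mono (h : ρ.IsExecution S) {i j : ℕ} (hij : i ≤ j) :
    (ρ.cfg i).net ⊆ (ρ.cfg j).net := by
  induction j, hij using Nat.le_induction with
  | base => exact subset_rfl
  | succ j _ ih => rw [h.step]; exact ih.trans (net_subset_effect _ _ _ _)

theorem taProposal_mono (h : ρ.IsExecution S) {V : Val} {A : UA} {sn : ℕ} {i j : ℕ} (hij : i ≤ j)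
    (hi : ((ρ.cfg i).ua V A).taProposal sn ≠ none) :
    ((ρ.cfg j).ua V A).taProposal sn ≠ none := by
  induction j, hij using Nat.le_induction with
  | base => exact hi
  | succ j _ ih => rw [h.step]; exact (effect_ua _ _ _ _ _ _ _).1 ih

theorem taDecision_mono (h : ρ.IsExecution S) {V : Val} {A : UA} {sn : ℕ} {i j : ℕ} (hij : i ≤ j)
    (hi : ((ρ.cfg i).ua V A).taDecision sn ≠ none) :
    ((ρ.cfg j).ua V A).taDecision sn ≠ none := by
  induction j, hij using Nat.le_induction with
  | base => exact hi
  | succ j _ ih => rw [h.step]; exact (effect_ua _ _ _ _ _ _ _).2 ih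

theorem instChange (h : ρ.IsExecution S) (V : Val) (X : RA) (k i : ℕ) :
    InstChange S (ρ.cfg i) (ρ.ev i) V X k ((ρ.cfg (i + 1)).at V X k) := by
  rw [h.step]; exact instChange_effect (h.enabled i) V X k

theorem at_zero (h : ρ.IsExecution S) (V : Val) (X : RA) (k : ℕ) :
    (ρ.cfg 0).at V X k = .initial := h.initial.ins V X k

/-- Whoever has voted has sent a ballot to everybody. -/
theorem exists_ballot_of_voted (h : ρ.IsExecution S) {V : Val} {X : RA} {k i : ℕ}
    (hi : ((ρ.cfg i).at V X k).voted = true) :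
    ∃ v fb t, ∀ U, ⟨V, U, X, .ballot k v fb, t⟩ ∈ (ρ.cfg i).net := by
  induction i with
  | zero => simp [h.at_zero, InstState.initial] at hi
  | succ i ih =>
    rcases (h.instChange V X k i).voted hi with hv | hv
    · obtain ⟨v, fb, t, hU⟩ := ih hv
      exact ⟨v, fb, t, fun U => h.net_mono (Nat.le_succ i) (hU U)⟩
    · obtain ⟨v, fb, hU⟩ := ballot_mem_effect_net (S := S) (t := ρ.time i) hv
      exact ⟨v, fb, ρ.time i, fun U => by rw [h.step]; exact hU U⟩

/-- Recorded votes have been sent. -/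
theorem exists_ballot_of_votes (h : ρ.IsExecution S) {V U : Val} {X : RA} {k i : ℕ} {B fb}
    (hi : ((ρ.cfg i).at V X k).votes U = some (some B, fb)) :
    ∃ pkt ∈ (ρ.cfg i).net, pkt.src = U ∧ pkt.actor = X ∧ pkt.msg = .ballot k (some B) fb := by
  induction i with
  | zero => simp [h.at_zero, InstState.initial] at hi
  | succ i ih =>
    obtain ⟨pkt, hp, hp'⟩ := ((h.instChange V X k i).votes U B fb hi).elim ih id
    exact ⟨pkt, h.net_mono (Nat.le_succ i) hp, hp'⟩

theorem validProof_mono (h : ρ.IsExecution S) {X : RA} {k i j : ℕ} {B s} (hij : i ≤ j)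
    (hi : ValidProof S (ρ.cfg i) X k B s) : ValidProof S (ρ.cfg j) X k B s :=
  hi.mono (h.net_mono hij)

theorem validProof_of_mem_proofs (h : ρ.IsExecution S) {V : Val} {X : RA} {k i : ℕ} {B s}
    (hi : (B, s) ∈ ((ρ.cfg i).at V X k).proofs) : ValidProof S (ρ.cfg i) X k B s := by
  induction i with
  | zero => simp [h.at_zero, InstState.initial] at hi
  | succ i ih =>
    exact h.validProof_mono (Nat.le_succ i) (((h.instChange V X k i).proofs B s hi).elim ih id)

/-- The proofs sent by honest validators are valid. -/
theorem validProof_of_mem_net (h : ρ.IsExecution S) {i k : ℕ} {B s}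
    {pkt : Packet Val UA RA Obj Code Sig} (hpkt : pkt ∈ (ρ.cfg i).net) (hsrc : S.Honest pkt.src)
    (hmsg : pkt.msg = .proof k B s) : ValidProof S (ρ.cfg i) pkt.actor k B s := by
  induction i with
  | zero => simp [h.initial.net] at hpkt
  | succ i ih =>
    refine h.validProof_mono (Nat.le_succ i) ?_
    have hen := h.enabled i
    rw [h.step] at hpkt
    rcases proof_mem_effect_net hen hpkt hsrc hmsg with hp | ⟨he, rfl⟩ | he
    · exact ih hp
    · rw [he] at hen
      -- A fresh proof: the guard of `fastDecide` gives the number of signers, and recorded votes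
      -- have been sent.
      refine ⟨hen.2.2, fun U hU _ => ?_⟩
      obtain ⟨fb, hfb⟩ := InstState.mem_votesFor.1 hU
      obtain ⟨pkt', h1, h2, h3, h4⟩ := h.exists_ballot_of_votes hfb
      exact ⟨pkt', h1, h2, h3, fb, h4⟩
    · rw [he] at hen
      exact h.validProof_of_mem_proofs hen.2.2

theorem taProposal_of_mem_taRequested (h : ρ.IsExecution S) {V : Val} {X : RA} {k i : ℕ} {u}
    (hi : u ∈ ((ρ.cfg i).at V X k).taRequested) :
    ((ρ.cfg i).ua V u.sender).taProposal u.sn ≠ none := by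
  induction i with
  | zero => simp [h.at_zero, InstState.initial] at hi
  | succ i ih =>
    rcases (h.instChange V X k i).taRequested u hi with hu | hu
    · exact h.taProposal_mono (Nat.le_succ i) (ih hu)
    · rw [h.step, hu]; exact effect_taRequest V X k u

/-- A decision in instance `k` moves the entity to `k + 1`, and it never returns to a lower
instance. This gives the first half of `DecidesAt`, that nothing was recorded before the event. -/
theorem decision_eq_none (h : ρ.IsExecution S) (V : Val) (X : RA) (k i : ℕ) :
    ((ρ.cfg i).ra V X).inst = none ∨ (∃ m ≤ k, ((ρ.cfg i).ra V X).inst = some m) →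
    ((ρ.cfg i).at V X k).decision = none := by
  induction i with
  | zero => simp [h.at_zero, InstState.initial]
  | succ i ih =>
    intro hm
    rcases (h.instChange V X k i).decision with hd | hd
    · rw [hd]
      apply ih
      rw [h.step] at hm
      rcases effect_inst (h.enabled i) V X with ⟨h1, -⟩ | ⟨-, h1, -⟩ | ⟨m, -, h1, h2⟩
      · rwa [h1] at hm
      · exact Or.inl h1
      · rw [h2] at hm
        rcases hm with hm | ⟨m', hm', hm⟩
        · simp at hm
        · injection hm with hm
          exact Or.inr ⟨m, by omega, h1⟩
    · rw [h.step, hd.effect_inst (h.enabled i)] at hm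
      rcases hm with hm | ⟨m', hm', hm⟩
      · simp at hm
      · injection hm with hm
        omega

theorem decidesAt (h : ρ.IsExecution S) {V : Val} {X : RA} {k i : ℕ}
    (hd : (ρ.ev i).DecidesInst V X k) : ∃ B, ρ.DecidesAt V X k B i := by
  obtain ⟨B, hB⟩ := hd.effect_decision (h.enabled i)
  rw [← h.step] at hB
  exact ⟨B, h.decision_eq_none V X k i (Or.inr ⟨k, le_rfl, hd.inst_eq (h.enabled i)⟩), hB⟩

theorem inst_of_not_decides (h : ρ.IsExecution S) {V : Val} {X : RA} {k i : ℕ}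
    (hi : ((ρ.cfg i).ra V X).inst = some k) (hd : ∀ j, ¬ (ρ.ev j).DecidesInst V X k) {j : ℕ}
    (hij : i ≤ j) : ((ρ.cfg j).ra V X).inst = some k ∧
      ((ρ.cfg j).ra V X).timerStart = ((ρ.cfg i).ra V X).timerStart := by
  induction j, hij using Nat.le_induction with
  | base => exact ⟨hi, rfl⟩
  | succ j _ ih =>
    rw [h.step]
    rcases effect_inst (h.enabled j) V X with ⟨h1, h2⟩ | ⟨-, h1, -⟩ | ⟨m, h0, h1, h2⟩
    · rw [h1, h2]; exact ih
    · simp [ih.1] at h1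
    · rw [ih.1] at h1
      injection h1 with h1
      exact absurd (h1 ▸ h0) (hd j)

/-! ### Liveness -/

theorem eventually_of_le {G : ℕ → Prop} (hG : ∀ i j, i ≤ j → G i → G j) {i : ℕ} (hi : G i) :
    ∀ᶠ j in atTop, G j :=
  eventually_atTop.2 ⟨i, fun j hj => hG i j hj hi⟩

/-- A persistent goal that is reached by a fair event is eventually reached if the event is enabled
until then. -/
theorem eventually_of_fair (h : ρ.IsExecution S) {e : Event Val UA RA Obj Code Sig}
    (he : e.IsProtocolStep) {G : Config Val UA RA Obj Code Sig → Prop}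
    (hmono : ∀ i j, i ≤ j → G (ρ.cfg i) → G (ρ.cfg j))
    (hen : ∀ᶠ j in atTop, ¬ G (ρ.cfg j) → Enabled S (ρ.time j) (ρ.cfg j) e)
    (hG : ∀ t c, Enabled S t c e → G (effect S t c e)) : ∀ᶠ j in atTop, G (ρ.cfg j) := by
  obtain ⟨i, hi⟩ := eventually_atTop.1 hen
  by_cases hex : ∃ j, G (ρ.cfg j)
  · obtain ⟨j, hj⟩ := hex
    exact eventually_of_le (G := fun j => G (ρ.cfg j)) hmono hj
  · push Not at hex
    obtain ⟨j, -, rfl⟩ := h.fair e he i fun j hj => hi j hj (hex j)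
    exact absurd (h.step j ▸ hG _ _ (h.enabled j)) (hex (j + 1))

/-- The protocol step is taken if it is eventually enabled forever. -/
theorem exists_ev_eq (h : ρ.IsExecution S) {e : Event Val UA RA Obj Code Sig}
    (he : e.IsProtocolStep) (hen : ∀ᶠ j in atTop, Enabled S (ρ.time j) (ρ.cfg j) e) :
    ∃ j, ρ.ev j = e := by
  obtain ⟨i, hi⟩ := eventually_atTop.1 hen
  obtain ⟨j, -, hj⟩ := h.fair e he i hi
  exact ⟨j, hj⟩

/-- Messages between honest validators are delivered. -/
theorem exists_deliver (h : ρ.IsExecution S) {i : ℕ} {pkt : Packet Val UA RA Obj Code Sig}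
    (hpkt : pkt ∈ (ρ.cfg i).net) (hs : S.Honest pkt.src) (hd : S.Honest pkt.dst) :
    ∃ j, ρ.ev j = .deliver pkt ∧ pkt ∈ (ρ.cfg j).net := by
  obtain ⟨j, hj, -⟩ := h.delivery i pkt hpkt hs hd
  -- The delivery assumption does not place `j` after `i`; that the packet is in the network at `j`
  -- comes from the guard of `deliver`.
  have := h.enabled j
  rw [hj] at this
  exact ⟨j, hj, this.2⟩

variable {V : Val} {X : RA} {k : ℕ}

/-! ### From the timeout to ballots from all honest validators. -/

theorem eventually_fpReply (h : ρ.IsExecution S) (hV : S.Honest V) {i : ℕ} {B}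
    (hi : ((ρ.cfg i).at V X k).fpBlock = some B) {u} (hu : u ∈ uaraTxs B) :
    ∀ᶠ j in atTop, ((ρ.cfg j).at V X k).fpReply u ≠ none := by
  have hmono : ∀ i j, i ≤ j → ((ρ.cfg i).at V X k).fpReply u ≠ none →
      ((ρ.cfg j).at V X k).fpReply u ≠ none := fun i j hij => (h.at_mono V X k hij).fpReply u
  have h1 : ∀ᶠ j in atTop, ((ρ.cfg j).at V X k).fpWait u ≠ none ∨
      ((ρ.cfg j).at V X k).fpReply u ≠ none := by
    refine h.eventually_of_fair (e := .fpLock V X k u) (G := fun c => (c.at V X k).fpWait u ≠ none ∨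
      (c.at V X k).fpReply u ≠ none) trivial (fun i j hij => ?_) ?_
      fun t c _ => effect_fpLock V X k u
    · refine Or.imp (fun hw => ?_) (hmono i j hij)
      obtain ⟨t, ht⟩ := Option.ne_none_iff_exists'.1 hw
      simp [(h.at_mono V X k hij).fpWait u t ht]
    · filter_upwards [eventually_ge_atTop i] with j hj hG
      push Not at hG
      exact ⟨hV, ⟨B, (h.at_mono V X k hj).fpBlock B hi, hu⟩, hG⟩
  obtain ⟨j, hj⟩ := h1.exists
  rcases hj with hj | hj
  · obtain ⟨t, ht⟩ := Option.ne_none_iff_exists'.1 hj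
    -- The negative answer is enabled forever after the waiting time `Δ`; if a positive answer comes
    -- first, the goal is reached as well.
    refine h.eventually_of_fair (e := .fpAnswer V X k u false)
      (G := fun c => (c.at V X k).fpReply u ≠ none) trivial hmono ?_ fun t c _ => by simp [effect]
    filter_upwards [eventually_ge_atTop j, h.time_unbounded.eventually_gt_atTop (t + S.Δ)]
      with l hl hl' hG
    exact ⟨hV, not_not.1 hG, t, (h.at_mono V X k hl).fpWait u t ht, Or.inr ⟨rfl, hl'⟩⟩
  · exact eventually_of_le (G := fun j => ((ρ.cfg j).at V X k).fpReply u ≠ none) hmono hj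

/-- A timeout without FP-lock requests sends a negative vote at once; otherwise all requests get
answered. The step `vote` is not tied to the current instance, so this holds even if `V` has moved
on. -/
theorem eventually_voted (h : ρ.IsExecution S) (hV : S.Honest V) {i : ℕ}
    (hi : ((ρ.cfg i).at V X k).timedOut = true) : ∃ j, ((ρ.cfg j).at V X k).voted = true := by
  rcases (h.coherent V X k i).timedOut hi with hB | hv
  · obtain ⟨B, hB⟩ := Option.ne_none_iff_exists'.1 hB
    refine (h.eventually_of_fair (e := .vote V X k) (G := fun c => (c.at V X k).voted = true)
      trivial (fun i j hij => (h.at_mono V X k hij).voted) ?_ fun t c _ => ?_).exists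
    · filter_upwards [eventually_ge_atTop i, (uaraTxs_finite B).eventually_all.2 fun u hu =>
        h.eventually_fpReply hV hB hu] with j hj hr hG
      exact ⟨hV, by simpa using hG, B, (h.at_mono V X k hj).fpBlock B hB, hr⟩
    · simp [effect]
  · exact ⟨i, hv⟩

theorem eventually_votes (h : ρ.IsExecution S) {U : Val} (hV : S.Honest V) (hU : S.Honest U)
    {i : ℕ} (hi : ((ρ.cfg i).at U X k).timedOut = true) :
    ∀ᶠ j in atTop, ((ρ.cfg j).at V X k).votes U ≠ none := by
  obtain ⟨j, hj⟩ := h.eventually_voted hU hi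
  obtain ⟨v, fb, t, hb⟩ := h.exists_ballot_of_voted hj
  obtain ⟨l, hl, -⟩ := h.exists_deliver (hb V) hU hV
  refine eventually_of_le (G := fun j => ((ρ.cfg j).at V X k).votes U ≠ none) (i := l + 1)
    (fun i j hij hv => ?_) ?_
  · obtain ⟨w, hw⟩ := Option.ne_none_iff_exists'.1 hv
    simp [(h.at_mono V X k hij).votes U w hw]
  · rw [h.step, hl]
    exact effect_deliver_ballot (pkt := ⟨U, V, X, .ballot k v fb, t⟩) rfl

theorem eventually_voters (h : ρ.IsExecution S) (hbyz : S.byz.card ≤ S.f) (hV : S.Honest V)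
    (hi : ∀ U, S.Honest U → ∃ i, ((ρ.cfg i).at U X k).timedOut = true) :
    ∀ᶠ j in atTop, Fintype.card Val - S.f ≤ ((ρ.cfg j).at V X k).voters.card := by
  classical
  have : ∀ᶠ j in atTop, ∀ U, S.Honest U → ((ρ.cfg j).at V X k).votes U ≠ none := by
    refine eventually_all.2 fun U => ?_
    by_cases hU : S.Honest U
    · obtain ⟨i, hi⟩ := hi U hU
      filter_upwards [h.eventually_votes hV hU hi] with j hj _ using hj
    · exact .of_forall fun j hU' => absurd hU' hU
  filter_upwards [this] with j hj
  calc Fintype.card Val - S.f ≤ Fintype.card Val - S.byz.card := by omega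
    _ = (S.byzᶜ).card := (Finset.card_compl _).symm
    _ ≤ _ := Finset.card_le_card fun U hU =>
      Finset.mem_filter.2 ⟨Finset.mem_univ _, hj U (Finset.mem_compl.1 hU)⟩

theorem votesFor_mono (h : ρ.IsExecution S) {i j : ℕ} (hij : i ≤ j) (B) :
    ((ρ.cfg i).at V X k).votesFor B ⊆ ((ρ.cfg j).at V X k).votesFor B := by
  intro U hU
  obtain ⟨fb, hfb⟩ := InstState.mem_votesFor.1 hU
  exact InstState.mem_votesFor.2 ⟨fb, (h.at_mono V X k hij).votes U _ hfb⟩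

/-! ### The slow path up to the proposal to Quorum Consensus. -/

theorem eventually_slowStarted (h : ρ.IsExecution S) (hV : S.Honest V)
    (hinst : ∀ᶠ j in atTop, ((ρ.cfg j).ra V X).inst = some k)
    {i : ℕ} (hi : ((ρ.cfg i).at V X k).timedOut = true)
    (hvoters : ∀ᶠ j in atTop, Fintype.card Val - S.f ≤ ((ρ.cfg j).at V X k).voters.card) :
    ∃ j, ((ρ.cfg j).at V X k).slowStarted = true := by
  have key : ∀ cand : Option (Block UA RA Obj Code Sig), (∀ᶠ j in atTop, match cand with
      | some B => Fintype.card Val - S.p - 2 * S.f ≤ (((ρ.cfg j).at V X k).votesFor B).card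
      | none => ∀ B, (((ρ.cfg j).at V X k).votesFor B).card < Fintype.card Val - S.p - 2 * S.f) →
      ∃ j, ((ρ.cfg j).at V X k).slowStarted = true := by
    intro cand hc
    refine (h.eventually_of_fair (e := .slowStart V X k cand)
      (G := fun c => (c.at V X k).slowStarted = true) trivial
      (fun i j hij => (h.at_mono V X k hij).slowStarted) ?_ fun t c _ => ?_).exists
    · filter_upwards [hinst, hvoters, hc, eventually_ge_atTop i] with j h1 h2 h3 h4 hG
      cases cand <;> exact ⟨hV, h1, (h.at_mono V X k h4).timedOut hi, by simpa using hG, h2, h3⟩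
    · simp [effect]
  -- Fairness concerns one event with fixed arguments, so the candidate has to be chosen in advance.
  -- A block that once has enough votes keeps them; if no block ever has, the event without
  -- candidate is never blocked by the votes.
  by_cases hB : ∃ B j, Fintype.card Val - S.p - 2 * S.f ≤ (((ρ.cfg j).at V X k).votesFor B).card
  · obtain ⟨B, j, hj⟩ := hB
    refine key (some B) ?_
    filter_upwards [eventually_ge_atTop j] with l hl
    exact hj.trans (Finset.card_le_card (h.votesFor_mono hl B))
  · push Not at hB
    exact key none (.of_forall fun j B => hB B j)

theorem eventually_qcProposal_of_needFallback (h : ρ.IsExecution S) (hV : S.Honest V) {i : ℕ}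
    (hi : ((ρ.cfg i).at V X k).needFallback = true) :
    ∃ j, ((ρ.cfg j).at V X k).qcProposal ≠ none := by
  have hs := (h.coherent V X k i).needFallback hi
  obtain ⟨i', hi'⟩ : ∃ j, ((ρ.cfg j).at V X k).candidate₂ ≠ none := by
    refine (h.eventually_of_fair (e := .fbStart V X k)
      (G := fun c => (c.at V X k).candidate₂ ≠ none) trivial (fun i j hij hc => ?_) ?_
      fun t c _ => ?_).exists
    · obtain ⟨B, hB⟩ := Option.ne_none_iff_exists'.1 hc
      simp [(h.at_mono V X k hij).candidate₂ B hB]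
    · filter_upwards [eventually_ge_atTop i] with j hj hG
      exact ⟨hV, (h.at_mono V X k hj).needFallback hs hi, not_not.1 hG⟩
    · simp [effect]
  obtain ⟨B, hB⟩ := Option.ne_none_iff_exists'.1 hi'
  have hr : ∀ᶠ j in atTop, ∀ u ∈ uaraTxs B, ((ρ.cfg j).at V X k).spReply₂ u ≠ none := by
    refine (uaraTxs_finite B).eventually_all.2 fun u hu => ?_
    refine h.eventually_of_fair (e := .spLock₂ V X k u)
      (G := fun c => (c.at V X k).spReply₂ u ≠ none) trivial
      (fun i j hij => (h.at_mono V X k hij).spReply₂ u) ?_ fun t c _ => by simp [effect]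
    filter_upwards [eventually_ge_atTop i'] with j hj hG
    exact ⟨hV, ⟨B, (h.at_mono V X k hj).candidate₂ B hB, hu⟩, not_not.1 hG⟩
  refine (h.eventually_of_fair (e := .fbPropose V X k)
    (G := fun c => (c.at V X k).qcProposal ≠ none) trivial
    (fun i j hij => (h.at_mono V X k hij).qcProposal) ?_ fun t c => effect_fbPropose V X k).exists
  filter_upwards [eventually_ge_atTop i', hr] with j hj hr hG
  exact ⟨hV, not_not.1 hG, B, (h.at_mono V X k hj).candidate₂ B hB, hr⟩

theorem eventually_qcProposal (h : ρ.IsExecution S) (hV : S.Honest V) {i : ℕ}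
    (hi : ((ρ.cfg i).at V X k).slowStarted = true) :
    ∃ j, ((ρ.cfg j).at V X k).qcProposal ≠ none := by
  rcases (h.coherent V X k i).split hi with hc | hn
  · obtain ⟨B, hB⟩ := Option.ne_none_iff_exists'.1 hc
    -- If the fallback is never needed, `slowPropose` cannot be blocked by it and can only end with
    -- a proposal.
    by_cases hf : ∃ j, ((ρ.cfg j).at V X k).needFallback = true
    · obtain ⟨j, hj⟩ := hf
      exact h.eventually_qcProposal_of_needFallback hV hj
    have hr : ∀ᶠ j in atTop, ∀ u ∈ uaraTxs B, ((ρ.cfg j).at V X k).spReply u ≠ none := by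
      refine (uaraTxs_finite B).eventually_all.2 fun u hu => ?_
      refine h.eventually_of_fair (e := .spLock V X k u)
        (G := fun c => (c.at V X k).spReply u ≠ none) trivial
        (fun i j hij => (h.at_mono V X k hij).spReply u) ?_ fun t c _ => by simp [effect]
      filter_upwards [eventually_ge_atTop i] with j hj hG
      exact ⟨hV, ⟨B, (h.at_mono V X k hj).candidate B hi hB, hu⟩, not_not.1 hG⟩
    obtain ⟨j, hj⟩ : ∃ j, ρ.ev j = .slowPropose V X k ∨
        ((ρ.cfg j).at V X k).qcProposal ≠ none := by
      by_contra! hcon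
      obtain ⟨j, hj⟩ := h.exists_ev_eq (e := .slowPropose V X k) trivial (by
        filter_upwards [eventually_ge_atTop i, hr] with j hj hr
        exact ⟨hV, by simpa using not_exists.1 hf j, (hcon j).2, B,
          (h.at_mono V X k hj).candidate B hi hB, hr⟩)
      exact (hcon j).1 hj
    rcases hj with hj | hj
    · refine ⟨j + 1, ?_⟩
      have := effect_slowPropose (S := S) (t := ρ.time j) (c := ρ.cfg j) V X k
      rw [← hj, ← h.step] at this
      exact this.resolve_right (not_exists.1 hf (j + 1))
    · exact ⟨j, hj⟩
  · exact h.eventually_qcProposal_of_needFallback hV hn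

/-! ### The consensus primitives and the slow decision. -/

/-- Agreement makes `B` independent of `U`. This matters because a Transaction Agreement is only
known to terminate if all honest validators propose in it, so they must hand over the same
transactions. -/
theorem exists_qcDecision (h : ρ.IsExecution S)
    (hq : ∀ U, S.Honest U → ∃ j, ((ρ.cfg j).at U X k).qcProposal ≠ none) (hV : S.Honest V) :
    ∃ B, ∀ U, S.Honest U → ∀ᶠ j in atTop, ((ρ.cfg j).at U X k).qcDecision = some B := by
  have hterm := (h.quorumConsensus X k).termination fun U hU => by
    obtain ⟨j, hj⟩ := hq U hU
    obtain ⟨B, hB⟩ := Option.ne_none_iff_exists'.1 hj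
    exact ⟨B, j, hB⟩
  obtain ⟨B, hB⟩ := hterm V hV
  refine ⟨B, fun U hU => ?_⟩
  obtain ⟨B', hB'⟩ := hterm U hU
  obtain rfl := (h.quorumConsensus X k).agreement V U B B' hV hU hB hB'
  obtain ⟨j, hj⟩ := hB'
  exact eventually_of_le (G := fun j => ((ρ.cfg j).at U X k).qcDecision = some B)
    (fun i j hij => (h.at_mono U X k hij).qcDecision B) hj

/-- The guard of `taRequest` does not mention the current instance: validators that have already
left instance `k` still hand over its transactions. -/
theorem eventually_mem_taRequested (h : ρ.IsExecution S) (hV : S.Honest V) {B}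
    (hB : ∀ᶠ j in atTop, ((ρ.cfg j).at V X k).qcDecision = some B) {u} (hu : u ∈ uaraTxs B) :
    ∀ᶠ j in atTop, u ∈ ((ρ.cfg j).at V X k).taRequested := by
  refine h.eventually_of_fair (e := .taRequest V X k u)
    (G := fun c => u ∈ (c.at V X k).taRequested) trivial
    (fun i j hij hm => (h.at_mono V X k hij).taRequested hm) ?_ fun t c _ => by simp [effect]
  filter_upwards [hB] with j hj hG
  exact ⟨hV, ⟨B, hj, hu⟩, hG⟩

theorem eventually_taReply (h : ρ.IsExecution S) (hV : S.Honest V) {B}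
    (hB : ∀ U, S.Honest U → ∀ᶠ j in atTop, ((ρ.cfg j).at U X k).qcDecision = some B) {u}
    (hu : u ∈ uaraTxs B) : ∀ᶠ j in atTop, ((ρ.cfg j).at V X k).taReply u ≠ none := by
  have hd : ∀ᶠ j in atTop, ((ρ.cfg j).ua V u.sender).taDecision u.sn ≠ none := by
    obtain ⟨v, j, hj⟩ := (h.transactionAgreement u.sender u.sn).termination (fun U hU => by
      obtain ⟨j, hj⟩ := (h.eventually_mem_taRequested hU (hB U hU) hu).exists
      obtain ⟨w, hw⟩ := Option.ne_none_iff_exists'.1 (h.taProposal_of_mem_taRequested hj)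
      exact ⟨w, j, hw⟩) V hV
    exact eventually_of_le (G := fun j => ((ρ.cfg j).ua V u.sender).taDecision u.sn ≠ none)
      (fun i j hij => h.taDecision_mono hij) (i := j) (by simp [hj])
  refine h.eventually_of_fair (e := .taAnswer V X k u)
    (G := fun c => (c.at V X k).taReply u ≠ none) trivial
    (fun i j hij => (h.at_mono V X k hij).taReply u) ?_ fun t c _ => by simp [effect]
  filter_upwards [hd, h.eventually_mem_taRequested hV (hB V hV) hu] with j h1 h2 hG
  exact ⟨hV, h2, not_not.1 hG, h1⟩

/-- If all honest validators propose in Quorum Consensus, nobody is stuck in the instance. -/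
theorem exists_slowDecide (h : ρ.IsExecution S) (hV : S.Honest V)
    (hinst : ∀ᶠ j in atTop, ((ρ.cfg j).ra V X).inst = some k)
    (hq : ∀ U, S.Honest U → ∃ j, ((ρ.cfg j).at U X k).qcProposal ≠ none) :
    ∃ j, ρ.ev j = .slowDecide V X k := by
  obtain ⟨B, hB⟩ := h.exists_qcDecision hq hV
  refine h.exists_ev_eq trivial ?_
  filter_upwards [hinst, hB V hV, (uaraTxs_finite B).eventually_all.2 fun u hu =>
    h.eventually_taReply hV hB hu] with j h1 h2 h3
  exact ⟨hV, h1, B, h2, h3⟩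

/-- Without a decision the timer is not restarted, while time is unbounded. -/
theorem exists_timedOut (h : ρ.IsExecution S) (hV : S.Honest V) {i : ℕ}
    (hi : ((ρ.cfg i).ra V X).inst = some k) (hd : ∀ j, ¬ (ρ.ev j).DecidesInst V X k) :
    ∃ j, ((ρ.cfg j).at V X k).timedOut = true := by
  refine (h.eventually_of_fair (e := .timeout V X k)
    (G := fun c => (c.at V X k).timedOut = true) trivial
    (fun i j hij => (h.at_mono V X k hij).timedOut) ?_ fun t c _ => effect_timeout V X k).exists
  filter_upwards [eventually_ge_atTop i, h.time_unbounded.eventually_gt_atTop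
    (3 * S.Δ + ((ρ.cfg i).ra V X).timerStart)] with j hj hj' hG
  obtain ⟨h1, h2⟩ := h.inst_of_not_decides hi hd hj
  exact ⟨hV, h1, by rw [h2]; linarith, by simpa using hG⟩

/-- A proof sent by an honest validator makes everybody decide. -/
theorem exists_proofDecide (h : ρ.IsExecution S) {U : Val} (hV : S.Honest V) (hU : S.Honest U)
    (hinst : ∀ᶠ j in atTop, ((ρ.cfg j).ra V X).inst = some k) {B s} {i : ℕ} {t : ℝ}
    (hi : ⟨U, V, X, .proof k B s, t⟩ ∈ (ρ.cfg i).net) :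
    ∃ j, ρ.ev j = .proofDecide V X k B s := by
  obtain ⟨l, hl, hl'⟩ := h.exists_deliver hi hU hV
  have hp : (B, s) ∈ ((ρ.cfg (l + 1)).at V X k).proofs := by
    rw [h.step, hl]
    exact effect_deliver_proof (pkt := ⟨U, V, X, .proof k B s, t⟩) rfl
      (h.validProof_of_mem_net hl' hU rfl)
  refine h.exists_ev_eq trivial ?_
  filter_upwards [hinst, eventually_ge_atTop (l + 1)] with j h1 h2
  exact ⟨hV, h1, (h.at_mono V X k h2).proofs hp⟩

/-! ### All honest validators pass through every instance. -/

/-- If all honest validators enter an instance, they all decide in it. -/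
theorem exists_decidesInst (h : ρ.IsExecution S) (hbyz : S.byz.card ≤ S.f)
    (hreach : ∀ U, S.Honest U → ∃ i, ((ρ.cfg i).ra U X).inst = some k) (hV : S.Honest V) :
    ∃ j, (ρ.ev j).DecidesInst V X k := by
  by_contra! hcon
  have hinst : ∀ U, S.Honest U → (∀ j, ¬ (ρ.ev j).DecidesInst U X k) →
      ∀ᶠ j in atTop, ((ρ.cfg j).ra U X).inst = some k := fun U hU hd => by
    obtain ⟨i, hi⟩ := hreach U hU
    filter_upwards [eventually_ge_atTop i] with j hj using (h.inst_of_not_decides hi hd hj).1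
  have hVk := hinst V hV hcon
  -- Votes and proofs are excluded as reasons for a decision of `U`, since the proof broadcast with
  -- it would make `V` decide; a slow decision presupposes a proposal.
  have hslow : ∀ U, S.Honest U → ∀ j, (ρ.ev j).DecidesInst U X k →
      ((ρ.cfg j).at U X k).qcProposal ≠ none := by
    intro U hU j hj
    have hnet : ∀ B s t, ⟨U, V, X, .proof k B s, t⟩ ∉ (ρ.cfg (j + 1)).net := fun B s t hp => by
      obtain ⟨l, hl⟩ := h.exists_proofDecide hV hU hVk hp
      exact hcon l (Or.inr (Or.inl ⟨B, s, hl⟩))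
    rcases hj with ⟨B, hj⟩ | ⟨B, s, hj⟩ | hj
    · refine absurd ?_ (hnet B (((ρ.cfg j).at U X k).votesFor B) (ρ.time j))
      rw [h.step, hj]
      exact fastDecide_proof_mem_net U V X k B
    · refine absurd ?_ (hnet B s (ρ.time j))
      rw [h.step, hj]
      exact proofDecide_proof_mem_net U V X k B s
    · have hen := h.enabled j
      rw [hj] at hen
      obtain ⟨-, -, B, hB, -⟩ := hen
      exact (h.coherent U X k j).qcDecision (by simp [hB])
  -- By coherence a proposal implies a started slow path, hence a timeout; those who never decide
  -- time out by themselves.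
  have htimed : ∀ U, S.Honest U → ∃ j, ((ρ.cfg j).at U X k).timedOut = true := by
    intro U hU
    by_cases hd : ∃ j, (ρ.ev j).DecidesInst U X k
    · obtain ⟨j, hj⟩ := hd
      have hc := h.coherent U X k j
      exact ⟨j, hc.slowStarted (hc.qcProposal (hslow U hU j hj))⟩
    · obtain ⟨i, hi⟩ := hreach U hU
      exact h.exists_timedOut hU hi (not_exists.1 hd)
  have hprop : ∀ U, S.Honest U → ∃ j, ((ρ.cfg j).at U X k).qcProposal ≠ none := by
    intro U hU
    by_cases hd : ∃ j, (ρ.ev j).DecidesInst U X k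
    · obtain ⟨j, hj⟩ := hd
      exact ⟨j, hslow U hU j hj⟩
    · obtain ⟨i, hi⟩ := htimed U hU
      obtain ⟨j, hj⟩ := h.eventually_slowStarted hU (hinst U hU (not_exists.1 hd)) hi
        (h.eventually_voters hbyz hU htimed)
      exact h.eventually_qcProposal hU hj
  obtain ⟨j, hj⟩ := h.exists_slowDecide hV hVk hprop
  exact hcon j (Or.inr (Or.inr hj))

/-- The only way out of the uninitialized state leads to instance `1`. An entity that never gets
there would remain uninitialized, with `init` enabled forever. -/
theorem exists_inst_eq_one (h : ρ.IsExecution S) (hV : S.Honest V) (X : RA) :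
    ∃ i, ((ρ.cfg i).ra V X).inst = some 1 := by
  by_contra! hcon
  have hnone : ∀ j, ((ρ.cfg j).ra V X).inst = none := by
    intro j
    induction j with
    | zero => exact h.initial.inst V X
    | succ j ih =>
      have h1 := hcon (j + 1)
      rw [h.step] at h1 ⊢
      rcases effect_inst (h.enabled j) V X with ⟨h2, -⟩ | ⟨-, -, h2⟩ | ⟨m, -, h2, -⟩
      · rw [h2, ih]
      · exact absurd h2 h1
      · simp [ih] at h2
  obtain ⟨j, hj⟩ := h.exists_ev_eq (e := .init V X) trivial (.of_forall fun j => ⟨hV, hnone j⟩)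
  refine hcon (j + 1) ?_
  rw [h.step, hj]
  rcases (ρ.cfg j).initiate_inst S (ρ.time j) V X 1 V X with ⟨-, -, hi⟩ | ⟨hi, -⟩
  · exact hi
  · simp at hi

/-- The induction hypothesis must cover all honest validators, because the termination of an
instance relies on everybody entering it. -/
theorem exists_inst_eq (h : ρ.IsExecution S) (hbyz : S.byz.card ≤ S.f) (X : RA) {k : ℕ}
    (hk : 1 ≤ k) : ∀ V, S.Honest V → ∃ i, ((ρ.cfg i).ra V X).inst = some k := by
  induction k, hk using Nat.le_induction with
  | base => exact fun V hV => h.exists_inst_eq_one hV X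
  | succ k _ ih =>
    intro V hV
    obtain ⟨j, hj⟩ := h.exists_decidesInst hbyz ih hV
    exact ⟨j + 1, by rw [h.step]; exact hj.effect_inst (h.enabled j)⟩

end Run.IsExecution

end Mangrove

theorem mainTheorem12 {Val UA RA Obj Code Sig : Type*} [Fintype Val]
    (S : Mangrove.Setting Val UA RA Obj Code Sig)
    (hn : 3 * S.f + 2 * S.p + 1 ≤ Fintype.card Val)
    (hbyz : S.byz.card ≤ S.f)
    (hΔ : 0 < S.Δ)
    (ρ : Mangrove.Run Val UA RA Obj Code Sig)
    (hρ : ρ.IsExecution S)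
    (V : Val) (hV : S.Honest V) (X : RA) (k : ℕ) (hk : 1 ≤ k) :
    ∃ (i : ℕ) (B : Mangrove.Block UA RA Obj Code Sig), ρ.DecidesAt V X k B i := by
  obtain ⟨i, hi⟩ := hρ.exists_decidesInst hbyz (hρ.exists_inst_eq hbyz X hk) hV
  exact ⟨i, hρ.decidesAt hi⟩
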